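/- Let $p$ be a prime number. For a group $G$ and $g\in G$, the primitive logarithm $\operatorname{plog}_G(g)$ is the largest positive integer $k$ such that $r^k=g$ for some $r\in G$; it is undefined if no largest such $k$ exists. The group $G$ is primitively stable if for every $g\in G\setminus\{e\}$ the number $\operatorname{plog}_G(g)$ is defined and, for all integers $n\ge 1$, $\operatorname{plog}_G(g^n)$ is defined and equals $n\cdot\operatorname{plog}_G(g)$. The group $G$ has unique roots if for all $x,y\in G$ and all integers $n\ge 1$, $x^n=y^n$ implies $x=y$. Let $\Upsilon$ be the class of primitively stable groups with unique roots. The pro-$p$ topology on $G$ is the topology with base the cosets $gN$, where $g\in G$ and $N$ is a normal subgroup of $G$ such that $G/N$ is a finite $p$-group. A subgroup $H\le G$ is $p$-isolated in $G$ if for every $f\in G$ and every prime $q\neq p$, $f^q\in H$ implies $f\in H$. The group $G$ is $p$-CSS if every $p$-isolated cyclic subgroup of $G$ is closed in the pro-$p$ topology on $G$. Let $\Gamma=(V\Gamma,E\Gamma)$ be a (finite or infinite) simplicial graph and let $\mathcal G=\{G_v\mid v\in V\Gamma\}$ be a family of groups such that every $G_v$ belongs to $\Upsilon$ and is $p$-CSS.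 Let $\Gamma\mathcal G$ be the graph product, that is, the quotient of the free product $\ast_{v\in V\Gamma}G_v$ by the relations $g_ug_v=g_vg_u$ for all $g_u\in G_u$, $g_v\in G_v$, $\{u,v\}\in E\Gamma$. Then $\Gamma\mathcal G$ belongs to $\Upsilon$ and is $p$-CSS. -/

import Mathlib

namespace ProPGraph

universe u v

/-- The graph product of the groups `G v` over the simplicial graph `Γ`: the free product of the
vertex groups modulo the relations `a * b = b * a` for `a ∈ G v`, `b ∈ G w`, `v` adjacent to `w`. -/
def GraphProduct {V : Type u} (Γ : SimpleGraph V) (G : V → Type v) [∀ v, Group (G v)] :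
    Type (max u v) :=
  Monoid.CoprodI G ⧸ Subgroup.normalClosure
    {x : Monoid.CoprodI G | ∃ v w : V, Γ.Adj v w ∧ ∃ (a : G v) (b : G w),
      x = Monoid.CoprodI.of a * Monoid.CoprodI.of b *
        (Monoid.CoprodI.of b * Monoid.CoprodI.of a)⁻¹}

instance {V : Type u} (Γ : SimpleGraph V) (G : V → Type v) [∀ v, Group (G v)] :
    Group (GraphProduct Γ G) :=
  inferInstanceAs (Group (Monoid.CoprodI G ⧸ Subgroup.normalClosure
    {x : Monoid.CoprodI G | ∃ v w : V, Γ.Adj v w ∧ ∃ (a : G v) (b : G w),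
      x = Monoid.CoprodI.of a * Monoid.CoprodI.of b *
        (Monoid.CoprodI.of b * Monoid.CoprodI.of a)⁻¹}))

/-- Unique Root property: for every `g` and every positive `n`, the equation `x ^ n = g` has at most
one solution. -/
def HasUniqueRoots (G : Type u) [Group G] : Prop :=
  ∀ (g : G) (n : ℕ), 0 < n → ∀ x y : G, x ^ n = g → y ^ n = g → x = y

/-- `k` is the primitive logarithm of `g`: the largest positive integer `n` such that `g` is an
`n`-th power. (It is not defined for `g` if there is no such `k`.) -/
def IsPlog {G : Type u} [Group G] (g : G) (k : ℕ) : Prop :=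
  IsGreatest {n : ℕ | 0 < n ∧ ∃ r : G, r ^ n = g} k

/-- `g` is primitively stable: its primitive logarithm `k` is defined, and for every positive `n`
the primitive logarithm of `g ^ n` is (defined and) equal to `n * k`. -/
def IsPrimitivelyStableElement {G : Type u} [Group G] (g : G) : Prop :=
  ∃ k : ℕ, IsPlog g k ∧ ∀ n : ℕ, 0 < n → IsPlog (g ^ n) (n * k)

/-- A group is primitively stable if all its non-trivial elements are. -/
def IsPrimitivelyStable (G : Type u) [Group G] : Prop :=
  ∀ g : G, g ≠ 1 → IsPrimitivelyStableElement g

/-- The class `Υ` of primitively stable groups with unique roots. -/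
def InUpsilon (G : Type u) [Group G] : Prop :=
  IsPrimitivelyStable G ∧ HasUniqueRoots G

/-- `N` is a co-`p`-finite subgroup of `G`: it is normal and `G ⧸ N` is a finite `p`-group. -/
def IsCoPFinite (p : ℕ) {G : Type u} [Group G] (N : Subgroup G) : Prop :=
  ∃ _ : N.Normal, Finite (G ⧸ N) ∧ IsPGroup p (G ⧸ N)

theorem isCoPFinite_top (p : ℕ) (G : Type u) [Group G] : IsCoPFinite p (⊤ : Subgroup G) :=
  by
  have : Subsingleton (G ⧸ (⊤ : Subgroup G)) := QuotientGroup.subsingleton_quotient_top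
  exact ⟨inferInstance, inferInstance, fun x => ⟨0, Subsingleton.elim _ _⟩⟩

theorem IsCoPFinite.inf {p : ℕ} {G : Type u} [Group G] {M N : Subgroup G}
    (hM : IsCoPFinite p M) (hN : IsCoPFinite p N) : IsCoPFinite p (M ⊓ N) := by
  obtain ⟨nM, fM, pM⟩ := hM
  obtain ⟨nN, fN, pN⟩ := hN
  have iM : M.FiniteIndex := Subgroup.finiteIndex_of_finite_quotient
  have iN : N.FiniteIndex := Subgroup.finiteIndex_of_finite_quotient
  refine ⟨inferInstance, inferInstance, fun x => ?_⟩
  obtain ⟨g, rfl⟩ := QuotientGroup.mk_surjective x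
  obtain ⟨a, ha⟩ := pM (g : G ⧸ M)
  obtain ⟨b, hb⟩ := pN (g : G ⧸ N)
  rw [← QuotientGroup.mk_pow, QuotientGroup.eq_one_iff] at ha hb
  refine ⟨a + b, ?_⟩
  rw [← QuotientGroup.mk_pow, QuotientGroup.eq_one_iff, Subgroup.mem_inf]
  constructor
  · rw [pow_add, pow_mul]; exact pow_mem ha _
  · rw [add_comm, pow_add, pow_mul]; exact pow_mem hb _

/-- The pro-`p` topology on `G`: the topology whose base consists of the cosets `g N` with `N` a
co-`p`-finite subgroup. Thus `U` is open iff every `g ∈ U` has such a coset `g N` inside `U`. -/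
@[reducible] def proPTopology (p : ℕ) (G : Type u) [Group G] : TopologicalSpace G where
  IsOpen U := ∀ g ∈ U, ∃ N : Subgroup G, IsCoPFinite p N ∧ ∀ n ∈ N, g * n ∈ U
  isOpen_univ := fun _ _ => ⟨⊤, isCoPFinite_top p G, fun _ _ => Set.mem_univ _⟩
  isOpen_inter := by
    intro U W hU hW g hg
    obtain ⟨M, hM, hMU⟩ := hU g hg.1
    obtain ⟨N, hN, hNW⟩ := hW g hg.2
    exact ⟨M ⊓ N, hM.inf hN, fun n hn => ⟨hMU n hn.1, hNW n hn.2⟩⟩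
  isOpen_sUnion := by
    intro S hS g hg
    obtain ⟨U, hUS, hgU⟩ := hg
    obtain ⟨N, hN, hNU⟩ := hS U hUS g hgU
    exact ⟨N, hN, fun n hn => ⟨U, hUS, hNU n hn⟩⟩

/-- `S` is `p`-separable in `G`: it is closed in the pro-`p` topology of `G`. -/
def IsPSeparable (p : ℕ) {G : Type u} [Group G] (S : Set G) : Prop :=
  @IsClosed G (proPTopology p G) S

/-- `H` is `p`-isolated in `G`: `f ^ q ∈ H` implies `f ∈ H` for every prime `q ≠ p`. -/
def IsPIsolated (p : ℕ) {G : Type u} [Group G] (H : Subgroup G) : Prop :=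
  ∀ (f : G) (q : ℕ), q.Prime → q ≠ p → f ^ q ∈ H → f ∈ H

/-- `G` is `p`-CSS: every `p`-isolated cyclic subgroup of `G` is `p`-separable in `G`. -/
def IsPCSS (p : ℕ) (G : Type u) [Group G] : Prop :=
  ∀ C : Subgroup G, IsCyclic C → IsPIsolated p C → IsPSeparable p (C : Set G)

end ProPGraph

/-! The two hypotheses are traded for `IsRootedPCSS`: every nontrivial element lies in an infinite
cyclic subgroup closed under taking roots, the group is residually a finite `p`-group, and those
isolated cyclic subgroups are closed in the pro-`p` topology. For `p` prime this is equivalent to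
being in `Υ` and `p`-CSS (`InUpsilon.isRooted`, `IsRooted.inUpsilon`, `IsPCSS.isRootedPCSS`,
`IsRootedPCSS.isPCSS`), and it is better suited to induction.

A graph product grows one vertex at a time. Let `A` be the full subgroup on a finite set `S`, let `v
∉ S`, and let `H ≤ A` be generated by the vertex groups in the link of `v`. Killing `G v` retracts
the full subgroup on `insert v S` onto `A`; the kernel is the free product of the conjugates of `G
v` by representatives of `A ⧸ H`. So that subgroup is the free wreath product `FreeWreath A (A ⧸ H)
(G v)`. As `H` is the fixed subgroup of an endomorphism of `A`, point stabilizers are closed under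
roots and distinct cosets are separated by finite `p`-quotients. This reduces finite graphs to
`isRootedPCSS_freeWreath`; infinite graphs follow because any finite set of elements lies in a
finite full subgroup, which is a retract.

For a free wreath product `E` with base the free power of `B`, let `s` be the isolated root of the
`A`-part of an element outside the base. The preimage of `⟨s⟩` is a free wreath product over `ℤ`
whose orbits are fixed points or regular, hence a free product of a free power of `B` with (free
power of `B` over the fixed points) `× ℤ` (`wreathEquiv`). Roots and commuting pairs are then read
off from normal forms in free products (`isRooted_coprodI`, `commute_cases`). To separate `g` from
`⟨r⟩`: if they do not commute, a quotient keeping the commutator alive suffices; if they commute,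
the structure of commuting pairs leads to `B × A`, to a retraction, or to a free abelian group of
rank two (`separated_of_rank_two`). Residual `p`-finiteness of `E` reduces to free products of
copies of a finite `p`-group, which act by triangular transformations (`isResiduallyP_coprodI`). -/

namespace ProPGraph

open Subgroup

/-! ### Isolated cyclic subgroups and their equivalence with the class `Υ`. -/

section Roots

variable {G : Type*} [Group G]

/-- `r` generates an infinite cyclic subgroup which is isolated: it contains every element some
positive power of which it contains. -/
structure IsIsolatedGenerator (r : G) : Prop where
  eq_zero_of_zpow : ∀ m : ℤ, r ^ m = 1 → m = 0
  mem_of_pow : ∀ (x : G) (n : ℕ), 0 < n → x ^ n ∈ zpowers r → x ∈ zpowers r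

/-- Every nontrivial element lies in an isolated infinite cyclic subgroup. -/
def IsRooted (G : Type*) [Group G] : Prop :=
  ∀ g : G, g ≠ 1 → ∃ r : G, IsIsolatedGenerator r ∧ g ∈ zpowers r

theorem IsIsolatedGenerator.ne_one {r : G} (h : IsIsolatedGenerator r) : r ≠ 1 := fun e => by
  have := h.eq_zero_of_zpow 1 (by simp [e])
  omega

theorem IsIsolatedGenerator.zpow_inj {r : G} (h : IsIsolatedGenerator r) {a b : ℤ}
    (e : r ^ a = r ^ b) : a = b := by
  have := h.eq_zero_of_zpow (a - b) (by rw [zpow_sub, e, mul_inv_cancel])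
  omega

theorem IsIsolatedGenerator.mem_of_zpow {r : G} (h : IsIsolatedGenerator r) {x : G} {n : ℤ}
    (hn : n ≠ 0) (hx : x ^ n ∈ zpowers r) : x ∈ zpowers r := by
  rcases Int.natAbs_eq n with e | e
  · exact h.mem_of_pow x n.natAbs (by omega) (by rw [e] at hx; exact_mod_cast hx)
  · refine h.mem_of_pow x n.natAbs (by omega) ?_
    rw [e, zpow_neg, inv_mem_iff] at hx
    exact_mod_cast hx

theorem IsIsolatedGenerator.inv {r : G} (h : IsIsolatedGenerator r) :
    IsIsolatedGenerator r⁻¹ := by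
  refine ⟨fun m hm => h.eq_zero_of_zpow m ?_, fun x n hn hx => ?_⟩
  · rwa [inv_zpow, inv_eq_one] at hm
  · rw [zpowers_inv] at hx ⊢
    exact h.mem_of_pow x n hn hx

theorem IsIsolatedGenerator.of_injective {H : Type*} [Group H] (f : G →* H)
    (hf : Function.Injective f) {r : G} (h : IsIsolatedGenerator (f r)) :
    IsIsolatedGenerator r := by
  refine ⟨fun m hm => h.eq_zero_of_zpow m (by rw [← map_zpow, hm, map_one]), fun x n hn hx => ?_⟩
  obtain ⟨m, hm⟩ := mem_zpowers_iff.1 hx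
  obtain ⟨k, hk⟩ := mem_zpowers_iff.1
    (h.mem_of_pow (f x) n hn ⟨m, by simp only [← map_zpow, hm, map_pow]⟩)
  exact ⟨k, hf (by simpa using hk)⟩

theorem IsIsolatedGenerator.of_conj {r c : G} (h : IsIsolatedGenerator (c * r * c⁻¹)) :
    IsIsolatedGenerator r :=
  .of_injective (MulAut.conj c).toMonoidHom (MulAut.conj c).injective (by simpa using h)

theorem IsIsolatedGenerator.conj {r : G} (h : IsIsolatedGenerator r) (c : G) :
    IsIsolatedGenerator (c * r * c⁻¹) :=
  .of_conj (c := c⁻¹) (by simpa [mul_assoc] using h)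

/-- An isolated generator generates every cyclic group that contains it. -/
theorem IsIsolatedGenerator.mem_zpowers_of_mem {r t g : G} (h : IsIsolatedGenerator r)
    (hr : r ∈ zpowers t) (hg : g ∈ zpowers t) : g ∈ zpowers r := by
  obtain ⟨k, rfl⟩ := mem_zpowers_iff.1 hr
  have hk : k ≠ 0 := by
    rintro rfl
    exact h.ne_one (by simp)
  exact (zpowers_le.2 (h.mem_of_zpow hk (mem_zpowers _))) hg

theorem IsRooted.eq_one_of_zpow (hG : IsRooted G) {x : G} {n : ℤ} (hn : n ≠ 0)
    (hx : x ^ n = 1) : x = 1 := by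
  by_contra hne
  obtain ⟨r, hr, hxr⟩ := hG x hne
  obtain ⟨k, rfl⟩ := mem_zpowers_iff.1 hxr
  rw [← zpow_mul] at hx
  rcases mul_eq_zero.1 (hr.eq_zero_of_zpow _ hx) with h | h
  · exact hne (by simp [h])
  · exact hn h

theorem IsRooted.eq_one_of_pow (hG : IsRooted G) {x : G} {n : ℕ} (hn : 0 < n)
    (hx : x ^ n = 1) : x = 1 :=
  hG.eq_one_of_zpow (n := n) (by omega) (by exact_mod_cast hx)

/-- Both elements are powers of one isolated generator, where exponents can be compared in `ℤ`. -/
theorem IsRooted.eq_of_pow_eq (hG : IsRooted G) {x y : G} {n : ℕ} (hn : 0 < n)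
    (h : x ^ n = y ^ n) : x = y := by
  by_cases hx : x = 1
  · subst hx
    exact (hG.eq_one_of_pow hn (by rw [← h, one_pow])).symm
  obtain ⟨r, hr, k, rfl⟩ := hG x hx
  simp only at h
  obtain ⟨l, rfl⟩ := mem_zpowers_iff.1
    (hr.mem_of_pow y n hn (by rw [← h]; exact pow_mem (zpow_mem (mem_zpowers r) _) _))
  have := hr.zpow_inj (a := k * n) (b := l * n) (by
    rw [zpow_mul, zpow_mul]; exact_mod_cast h)
  rw [mul_right_cancel₀ (by exact_mod_cast hn.ne') this]

theorem isRooted_of_subsingleton [Subsingleton G] : IsRooted G :=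
  fun g hg => absurd (Subsingleton.elim g 1) hg

theorem IsRooted.of_mulEquiv {H : Type*} [Group H] (e : G ≃* H) (hG : IsRooted G) :
    IsRooted H := by
  intro g hg
  obtain ⟨r, hr, k, hk⟩ := hG (e.symm g) (by simpa using hg)
  refine ⟨e r, .of_injective e.symm.toMonoidHom e.symm.injective (by simpa using hr), k, ?_⟩
  simp only at hk ⊢
  rw [← map_zpow, hk, MulEquiv.apply_symm_apply]

theorem IsRooted.exists_pow_eq (hG : IsRooted G) {g : G} (hg : g ≠ 1) :
    ∃ (r : G) (k : ℕ), IsIsolatedGenerator r ∧ 0 < k ∧ r ^ k = g := by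
  obtain ⟨r, hr, hgr⟩ := hG g hg
  obtain ⟨k, rfl⟩ := mem_zpowers_iff.1 hgr
  have hk : k ≠ 0 := by
    rintro rfl
    exact hg (by simp)
  rcases Int.natAbs_eq k with e | e
  · exact ⟨r, k.natAbs, hr, by omega, by conv_rhs => rw [e, zpow_natCast]⟩
  · exact ⟨r⁻¹, k.natAbs, hr.inv, by omega, by
      conv_rhs => rw [e, zpow_neg, zpow_natCast]
      rw [inv_pow]⟩

/-- Every `n`-th root of `r ^ k` is again a power of `r`, which forces `n ∣ k`. -/
theorem IsIsolatedGenerator.isPlog_pow {r : G} (hr : IsIsolatedGenerator r) {k : ℕ}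
    (hk : 0 < k) : IsPlog (r ^ k) k := by
  refine ⟨⟨hk, r, rfl⟩, ?_⟩
  rintro n ⟨hn, s, hs⟩
  obtain ⟨i, rfl⟩ := mem_zpowers_iff.1
    (hr.mem_of_pow s n hn (by rw [hs]; exact pow_mem (mem_zpowers r) _))
  have h : i * n = k := hr.zpow_inj (by rw [zpow_mul]; exact_mod_cast hs)
  have : (n : ℤ) ∣ k := ⟨i, by rw [← h, mul_comm]⟩
  exact Nat.le_of_dvd hk (by exact_mod_cast this)

theorem IsRooted.inUpsilon (hG : IsRooted G) : InUpsilon G := by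
  refine ⟨fun g hg => ?_, fun g n hn x y hx hy => hG.eq_of_pow_eq hn (hx.trans hy.symm)⟩
  obtain ⟨r, k, hr, hk, rfl⟩ := hG.exists_pow_eq hg
  refine ⟨k, hr.isPlog_pow hk, fun n hn => ?_⟩
  rw [← pow_mul, mul_comm k n]
  exact hr.isPlog_pow (Nat.mul_pos hn hk)

theorem IsPlog.unique {g : G} {a b : ℕ} (ha : IsPlog g a) (hb : IsPlog g b) : a = b :=
  IsGreatest.unique ha hb

/-- In a group of the class `Υ`, every nontrivial element is a positive power of an element all
positive powers of which have the obvious primitive logarithm. -/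
theorem InUpsilon.exists_pow_eq (hG : InUpsilon G) {g : G} (hg : g ≠ 1) :
    ∃ (r : G) (k : ℕ), 0 < k ∧ r ^ k = g ∧ ∀ n : ℕ, 0 < n → IsPlog (r ^ n) n := by
  obtain ⟨k, hk, -⟩ := hG.1 g hg
  obtain ⟨hk0, r, hrk⟩ := hk.1
  have hr : r ≠ 1 := by
    rintro rfl
    exact hg (by rw [← hrk, one_pow])
  obtain ⟨i, -, hi⟩ := hG.1 r hr
  -- Stability at `r` gives `r ^ k` the primitive logarithm `k * i`, while `k` was chosen as the
  -- primitive logarithm of `g = r ^ k`.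
  have h1 : i = 1 := by
    have := (hi k hk0).unique (hrk ▸ hk)
    exact Nat.eq_of_mul_eq_mul_left hk0 (by omega)
  subst h1
  exact ⟨r, k, hk0, hrk, fun n hn => by simpa using hi n hn⟩

/-- A root of maximal exponent generates an isolated subgroup. If `x ^ n = r ^ m` with `m > 0` and
`x = t ^ j` for a similarly maximal root `t`, comparing primitive logarithms gives `j * n = m`, so
`t ^ m = r ^ m` and `t = r` by uniqueness of roots. -/
theorem InUpsilon.isRooted (hG : InUpsilon G) : IsRooted G := by
  have tf : ∀ (x : G) (n : ℕ), 0 < n → x ^ n = 1 → x = 1 := fun x n hn hx =>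
    hG.2 1 n hn x 1 hx (one_pow n)
  intro g hg
  obtain ⟨r, k, hk, rfl, hr⟩ := hG.exists_pow_eq hg
  have hr1 : r ≠ 1 := by
    rintro rfl
    exact hg (one_pow k)
  have key : ∀ (x : G) (n m : ℕ), 0 < n → x ^ n = r ^ m → x ∈ zpowers r := by
    intro x n m hn hx
    by_cases hx1 : x = 1
    · rw [hx1]; exact one_mem _
    have hm : 0 < m := by
      rcases Nat.eq_zero_or_pos m with rfl | h
      · exact absurd (tf x n hn (by simpa using hx)) hx1
      · exact h
    obtain ⟨t, j, hj, rfl, ht⟩ := hG.exists_pow_eq hx1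
    rw [← pow_mul] at hx
    have e := (ht (j * n) (Nat.mul_pos hj hn)).unique (hx ▸ hr m hm)
    rw [hG.2 (r ^ m) m hm t r (by rw [← hx, e]) rfl]
    exact pow_mem (mem_zpowers r) _
  refine ⟨r, ⟨fun m hm => ?_, fun x n hn hx => ?_⟩, pow_mem (mem_zpowers r) _⟩
  · by_contra h0
    refine hr1 (tf r m.natAbs (by omega) ?_)
    rcases Int.natAbs_eq m with e | e
    · rw [e] at hm; exact_mod_cast hm
    · rw [e, zpow_neg, inv_eq_one] at hm; exact_mod_cast hm
  · obtain ⟨m, hm⟩ := mem_zpowers_iff.1 hx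
    rcases Int.natAbs_eq m with e | e
    · refine key x n m.natAbs hn ?_
      rw [← hm, ← zpow_natCast r, ← e]
    · refine inv_mem_iff.1 (key x⁻¹ n m.natAbs hn ?_)
      rw [inv_pow, ← hm, ← zpow_neg, ← zpow_natCast]
      congr 1
      omega

/-- When both coordinates are nontrivial, say `r ^ k` and `s ^ l`, the root is obtained by dividing
`k` and `l` by their gcd: a pair of exponents proportional to a coprime pair is an integral multiple
of it. -/
theorem IsRooted.prod {H : Type*} [Group H] (hG : IsRooted G) (hH : IsRooted H) :
    IsRooted (G × H) := by
  rintro ⟨a, b⟩ hab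
  by_cases ha : a = 1
  · subst ha
    have hb : b ≠ 1 := fun h => hab (by rw [h]; rfl)
    obtain ⟨s, hs, k, rfl⟩ := hH b hb
    refine ⟨(1, s), ⟨fun m hm => hs.eq_zero_of_zpow m (by simpa using hm), ?_⟩, k, by simp⟩
    rintro ⟨x, y⟩ n hn ⟨m, hm⟩
    simp only [Prod.pow_mk, one_zpow, Prod.mk.injEq] at hm
    obtain ⟨j, rfl⟩ := mem_zpowers_iff.1 (hs.mem_of_pow y n hn ⟨m, hm.2⟩)
    exact ⟨j, by simp [hG.eq_one_of_pow hn hm.1.symm]⟩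
  by_cases hb : b = 1
  · subst hb
    obtain ⟨s, hs, k, rfl⟩ := hG a ha
    refine ⟨(s, 1), ⟨fun m hm => hs.eq_zero_of_zpow m (by simpa using hm), ?_⟩, k, by simp⟩
    rintro ⟨x, y⟩ n hn ⟨m, hm⟩
    simp only [Prod.pow_mk, one_zpow, Prod.mk.injEq] at hm
    obtain ⟨j, rfl⟩ := mem_zpowers_iff.1 (hs.mem_of_pow x n hn ⟨m, hm.1⟩)
    exact ⟨j, by simp [hH.eq_one_of_pow hn hm.2.symm]⟩
  obtain ⟨r, hr, k, rfl⟩ := hG a ha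
  obtain ⟨s, hs, l, rfl⟩ := hH b hb
  simp only at ha hb hab ⊢
  have hk : k ≠ 0 := fun h => ha (by simp [h])
  obtain ⟨d, k', l', hco, rfl, rfl⟩ : ∃ d k' l' : ℤ, IsCoprime k' l' ∧ k = k' * d ∧
      l = l' * d := by
    obtain ⟨k', l', hco, h1, h2⟩ := Int.exists_gcd_one (m := k) (n := l)
      (Int.gcd_pos_of_ne_zero_left _ hk)
    exact ⟨_, k', l', Int.isCoprime_iff_gcd_eq_one.2 hco, h1, h2⟩
  refine ⟨(r ^ k', s ^ l'), ⟨fun m hm => ?_, ?_⟩, d, by simp [zpow_mul]⟩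
  · simp only [Prod.pow_mk, ← zpow_mul, Prod.mk_eq_one] at hm
    exact (mul_eq_zero.1 (hr.eq_zero_of_zpow _ hm.1)).resolve_left
      (fun h => hk (by simp [h]))
  · rintro ⟨x, y⟩ n hn ⟨m, hm⟩
    simp only [Prod.pow_mk, ← zpow_mul, Prod.mk.injEq] at hm
    obtain ⟨i, rfl⟩ := mem_zpowers_iff.1 (hr.mem_of_pow x n hn ⟨_, hm.1⟩)
    obtain ⟨j, rfl⟩ := mem_zpowers_iff.1 (hs.mem_of_pow y n hn ⟨_, hm.2⟩)
    have e1 : k' * m = i * n := hr.zpow_inj (by rw [hm.1, zpow_mul, zpow_natCast])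
    have e2 : l' * m = j * n := hs.zpow_inj (by rw [hm.2, zpow_mul, zpow_natCast])
    have e3 : i * l' = j * k' := by
      have hn' : (n : ℤ) ≠ 0 := by omega
      refine mul_right_cancel₀ hn' ?_
      linear_combination k' * e2 - l' * e1
    have hk' : k' ≠ 0 := fun h => hk (by simp [h])
    obtain ⟨c, rfl⟩ : k' ∣ i := hco.dvd_of_dvd_mul_right ⟨j, by rw [e3, mul_comm]⟩
    refine ⟨c, ?_⟩
    have : j = l' * c := mul_right_cancel₀ hk' (by rw [← e3]; ring)
    simp [this, zpow_mul]

theorem isRooted_multiplicative_int : IsRooted (Multiplicative ℤ) := by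
  intro g _
  have hz : ∀ x : Multiplicative ℤ, x ∈ zpowers (Multiplicative.ofAdd (1 : ℤ)) := fun x =>
    ⟨x.toAdd, by simp [← ofAdd_zsmul]⟩
  exact ⟨Multiplicative.ofAdd 1, ⟨fun m hm => by simpa [← ofAdd_zsmul] using hm,
    fun x _ _ _ => hz x⟩, hz g⟩

end Roots

/-! ### Separation of cyclic subgroups in finite `p`-quotients. -/

section Separation

variable {p : ℕ} {G : Type*} [Group G]

theorem isCoPFinite_iff {N : Subgroup G} :
    IsCoPFinite p N ↔ N.Normal ∧ N.FiniteIndex ∧ ∀ x : G, ∃ k : ℕ, x ^ p ^ k ∈ N := by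
  constructor
  · rintro ⟨hN, hfin, hp⟩
    refine ⟨hN, finiteIndex_of_finite_quotient, fun x => ?_⟩
    obtain ⟨k, hk⟩ := hp (x : G ⧸ N)
    exact ⟨k, by rwa [← QuotientGroup.mk_pow, QuotientGroup.eq_one_iff] at hk⟩
  · rintro ⟨hN, hfin, hp⟩
    refine ⟨hN, inferInstance, fun x => ?_⟩
    obtain ⟨g, rfl⟩ := QuotientGroup.mk_surjective x
    obtain ⟨k, hk⟩ := hp g
    exact ⟨k, by rwa [← QuotientGroup.mk_pow, QuotientGroup.eq_one_iff]⟩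

theorem IsCoPFinite.comap {H : Type*} [Group H] (f : G →* H) {N : Subgroup H}
    (h : IsCoPFinite p N) : IsCoPFinite p (N.comap f) := by
  obtain ⟨h1, h2, h3⟩ := isCoPFinite_iff.1 h
  refine isCoPFinite_iff.2 ⟨inferInstance, ⟨?_⟩, fun x => ?_⟩
  · rw [index_comap]
    exact (inferInstance : (N.subgroupOf f.range).FiniteIndex).index_ne_zero
  obtain ⟨k, hk⟩ := h3 (f x)
  exact ⟨k, by simpa using hk⟩

theorem isCoPFinite_ker {U : Type*} [Group U] [Finite U] (hU : IsPGroup p U) (f : G →* U) :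
    IsCoPFinite p f.ker := by
  have : IsCoPFinite p (⊥ : Subgroup U) :=
    isCoPFinite_iff.2 ⟨inferInstance, inferInstance, fun x => by simpa using hU x⟩
  exact this.comap f

theorem IsCoPFinite.exists_exponent (hp : p.Prime) {N : Subgroup G} (h : IsCoPFinite p N) :
    ∃ e : ℕ, ∀ x : G, x ^ p ^ e ∈ N := by
  obtain ⟨hN, hfin, hpg⟩ := h
  have := Fact.mk hp
  obtain ⟨e, he⟩ := IsPGroup.iff_card.1 hpg
  refine ⟨e, fun x => ?_⟩
  rw [← QuotientGroup.eq_one_iff, QuotientGroup.mk_pow, ← he]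
  exact pow_card_eq_one'

/-- A co-`p`-finite subgroup of a co-`p`-finite subgroup contains a co-`p`-finite subgroup. -/
theorem IsCoPFinite.normalCore (hp : p.Prime) {M N : Subgroup G} (hM : IsCoPFinite p M)
    (hNM : N ≤ M) (hN : IsCoPFinite p (N.subgroupOf M)) : IsCoPFinite p N.normalCore := by
  obtain ⟨e, he⟩ := hN.exists_exponent hp
  obtain ⟨hMn, hMf, hMp⟩ := isCoPFinite_iff.1 hM
  obtain ⟨-, hNf, -⟩ := isCoPFinite_iff.1 hN
  have hidx : N.FiniteIndex := by
    refine ⟨fun h => ?_⟩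
    rw [← relIndex_mul_index hNM] at h
    rcases mul_eq_zero.1 h with h | h
    · exact hNf.index_ne_zero h
    · exact hMf.index_ne_zero h
  refine isCoPFinite_iff.2 ⟨inferInstance, inferInstance, fun x => ?_⟩
  obtain ⟨k, hk⟩ := hMp x
  -- The exponent `p ^ e` is uniform over `M`, so all conjugates of `x ^ p ^ k`, which stay in `M`,
  -- have their `p ^ e`-th powers in `N`.
  refine ⟨k + e, fun g => ?_⟩
  have h1 : g * x ^ p ^ k * g⁻¹ ∈ M := hMn.conj_mem _ hk g
  have h2 := he ⟨_, h1⟩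
  rw [mem_subgroupOf] at h2
  simpa [pow_add, pow_mul] using h2

/-- `G` is residually a finite `p`-group. -/
def IsResiduallyP (p : ℕ) (G : Type*) [Group G] : Prop :=
  ∀ g : G, g ≠ 1 → ∃ N : Subgroup G, IsCoPFinite p N ∧ g ∉ N

/-- Some finite `p`-quotient separates `g` from the cyclic subgroup generated by `r`. -/
def Separated (p : ℕ) {G : Type*} [Group G] (r g : G) : Prop :=
  ∃ N : Subgroup G, IsCoPFinite p N ∧ ∀ m : ℤ, r ^ m * g ∉ N

theorem Separated.of_hom {H : Type*} [Group H] (f : G →* H) {r g : G}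
    (h : Separated p (f r) (f g)) : Separated p r g := by
  obtain ⟨N, hN, hm⟩ := h
  exact ⟨N.comap f, hN.comap f, fun m => by simpa using hm m⟩

theorem Separated.of_conj {r g c : G} (h : Separated p r g) :
    Separated p (c * r * c⁻¹) (c * g * c⁻¹) :=
  .of_hom (MulAut.conj c⁻¹).toMonoidHom (by simpa [mul_assoc] using h)

theorem Separated.of_mem_zpowers {r s g : G} (h : Separated p s g) (hr : r ∈ zpowers s) :
    Separated p r g := by
  obtain ⟨N, hN, hm⟩ := h
  obtain ⟨k, rfl⟩ := mem_zpowers_iff.1 hr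
  exact ⟨N, hN, fun m => by rw [← zpow_mul]; exact hm _⟩

theorem IsResiduallyP.separated_one (hG : IsResiduallyP p G) {g : G} (hg : g ≠ 1) :
    Separated p 1 g := by
  obtain ⟨N, hN, h⟩ := hG g hg
  exact ⟨N, hN, fun m => by simpa using h⟩

/-- If `r ^ m * g ∈ N`, then modulo `N` the element `g` is a power of `r` and commutes with it; so
any `N` avoiding the commutator works. -/
theorem IsResiduallyP.separated_of_not_commute (hG : IsResiduallyP p G) {r g : G}
    (h : r * g ≠ g * r) : Separated p r g := by
  obtain ⟨N, hN, hnot⟩ := hG (r * g * (g * r)⁻¹) (fun e => h (mul_inv_eq_one.1 e))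
  refine ⟨N, hN, fun m hm => hnot ?_⟩
  have hn := hN.1
  rw [← QuotientGroup.eq_one_iff] at hm ⊢
  simp only [QuotientGroup.mk_mul, QuotientGroup.mk_zpow, QuotientGroup.mk_inv] at hm ⊢
  rw [mul_inv_eq_one, eq_inv_of_mul_eq_one_right hm, ← zpow_neg, ← zpow_one_add, ← zpow_add_one,
    add_comm]

/-- Since `σ` fixes `r`, having both `r ^ m * g` and its image under `σ` in `N` would put `(σ g)⁻¹ *
g` in `N`. -/
theorem IsResiduallyP.separated_of_retraction (hG : IsResiduallyP p G) (σ : G →* G) {r g : G}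
    (hr : σ r = r) (hg : σ g ≠ g) : Separated p r g := by
  obtain ⟨N, hN, hnot⟩ := hG ((σ g)⁻¹ * g) (fun e => hg (inv_mul_eq_one.1 e))
  refine ⟨N ⊓ N.comap σ, hN.inf (hN.comap σ), fun m hm => hnot ?_⟩
  have h1 := hm.1
  have h2 : σ (r ^ m * g) ∈ N := hm.2
  rw [map_mul, map_zpow, hr] at h2
  have := mul_mem (inv_mem h2) h1
  simpa [mul_assoc] using this

/-- Modulo an `N` avoiding `t ^ p ^ (M - 1)`, the order of `t` is a power of `p` not dividing `p ^
(M - 1)`, hence a multiple of `p ^ M`. -/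
theorem IsResiduallyP.exists_dvd (hp : p.Prime) (hG : IsResiduallyP p G) {t : G}
    (ht : ∀ m : ℤ, t ^ m = 1 → m = 0) (M : ℕ) :
    ∃ N : Subgroup G, IsCoPFinite p N ∧ ∀ i : ℤ, t ^ i ∈ N → (p : ℤ) ^ M ∣ i := by
  rcases M with - | M
  · exact ⟨⊤, isCoPFinite_top p G, by simp⟩
  obtain ⟨N, hN, hnot⟩ := hG (t ^ ((p : ℤ) ^ M)) (fun h => by
    have := ht _ h
    exact pow_ne_zero M (by exact_mod_cast hp.ne_zero) this)
  obtain ⟨e, he⟩ := hN.exists_exponent hp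
  refine ⟨N, hN, fun i hi => ?_⟩
  have h1 : t ^ (Int.gcd i ((p : ℤ) ^ e) : ℤ) ∈ N := by
    rw [Int.gcd_eq_gcd_ab, zpow_add, zpow_mul, zpow_mul]
    refine mul_mem (zpow_mem hi _) (zpow_mem ?_ _)
    have := he t
    exact_mod_cast this
  have h2 : Int.gcd i ((p : ℤ) ^ e) ∣ p ^ e := by
    have := Int.gcd_dvd_right i ((p : ℤ) ^ e)
    exact_mod_cast this
  obtain ⟨c, -, hc⟩ := (Nat.dvd_prime_pow hp).1 h2
  by_cases hcM : c ≤ M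
  · refine absurd ?_ hnot
    obtain ⟨d, rfl⟩ := Nat.exists_eq_add_of_le hcM
    rw [pow_add, zpow_mul]
    refine zpow_mem ?_ _
    rw [hc] at h1
    exact_mod_cast h1
  · have h3 : (p : ℤ) ^ c ∣ i := by
      have := Int.gcd_dvd_left i ((p : ℤ) ^ e)
      rw [hc] at this
      exact_mod_cast this
    exact (pow_dvd_pow _ (by omega)).trans h3

/-- Separation inside a free abelian subgroup of rank two, one generator of which survives in a
residually `p`-finite quotient that kills the other. -/
theorem separated_of_rank_two {A : Type*} [Group A] (hp : p.Prime) (hG : IsResiduallyP p G)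
    (hA : IsResiduallyP p A) (π : G →* A) {t s : G} (hts : Commute t s) (hπ : π t = 1)
    (ht : ∀ m : ℤ, t ^ m = 1 → m = 0) (hs : ∀ m : ℤ, π s ^ m = 1 → m = 0) {k l k' l' : ℤ}
    (hne : k' * l ≠ k * l') : Separated p (t ^ k * s ^ l) (t ^ k' * s ^ l') := by
  set D := (k' * l - k * l').natAbs with hD
  -- The precision `p ^ D` is enough because a nonzero `D` is never divisible by `p ^ D > D`.
  have hD0 : D ≠ 0 := by
    rw [hD, Int.natAbs_ne_zero]
    omega
  obtain ⟨N₁, hN₁, h1⟩ := hG.exists_dvd hp ht D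
  obtain ⟨e, he⟩ := hN₁.exists_exponent hp
  -- Precision at least `e` in the exponent of `s` puts the power of `s` inside `N₁`, so the
  -- exponent of `t` can then be read modulo `N₁`.
  obtain ⟨N₂, hN₂, h2⟩ := hA.exists_dvd hp hs (max D e)
  refine ⟨N₁ ⊓ N₂.comap π, hN₁.inf (hN₂.comap π), fun m hm => ?_⟩
  have e1 : (t ^ k * s ^ l) ^ m * (t ^ k' * s ^ l') = t ^ (k * m + k') * s ^ (l * m + l') := by
    rw [(hts.zpow_zpow k l).mul_zpow, ← zpow_mul, ← zpow_mul, zpow_add, zpow_add, mul_assoc,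
      ← mul_assoc (s ^ (l * m)), ((hts.zpow_zpow k' (l * m)).eq).symm]
    simp only [mul_assoc]
  rw [e1] at hm
  have h3 : (p : ℤ) ^ max D e ∣ l * m + l' := by
    refine h2 _ ?_
    have : π (t ^ (k * m + k') * s ^ (l * m + l')) ∈ N₂ := hm.2
    simpa [hπ] using this
  have h4 : s ^ (l * m + l') ∈ N₁ := by
    obtain ⟨c, hc⟩ := (pow_dvd_pow (p : ℤ) (le_max_right D e)).trans h3
    rw [hc, zpow_mul]
    refine zpow_mem ?_ _
    have := he s
    exact_mod_cast this
  have h5 : (p : ℤ) ^ D ∣ k * m + k' := h1 _ ((mul_mem_cancel_right h4).1 hm.1)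
  -- Eliminating `m` from the two congruences leaves the determinant.
  have h6 : (p : ℤ) ^ D ∣ k' * l - k * l' := by
    have h7 := (pow_dvd_pow (p : ℤ) (le_max_left D e)).trans h3
    have h9 : k' * l - k * l' = l * (k * m + k') - k * (l * m + l') := by ring
    rw [h9]
    exact dvd_sub (h5.mul_left l) (h7.mul_left k)
  have h8 : p ^ D ∣ D := by
    have := Int.natAbs_dvd_natAbs.2 h6
    rwa [Int.natAbs_pow, Int.natAbs_natCast] at this
  exact absurd (Nat.le_of_dvd (Nat.pos_of_ne_zero hD0) h8)
    (not_le.2 (Nat.lt_pow_self hp.one_lt))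

/-- Every isolated infinite cyclic subgroup is closed in the pro-`p` topology. -/
def SeparatesIsolated (p : ℕ) (G : Type*) [Group G] : Prop :=
  ∀ r g : G, IsIsolatedGenerator r → g ∉ zpowers r → Separated p r g

/-- The conjunction of conditions which, by `IsRootedPCSS.isPCSS` and its converse, characterizes
the `p`-CSS groups of the class `Υ`. -/
structure IsRootedPCSS (p : ℕ) (G : Type*) [Group G] : Prop where
  isRooted : IsRooted G
  isResiduallyP : IsResiduallyP p G
  separatesIsolated : SeparatesIsolated p G

theorem isPSeparable_zpowers_iff {r : G} :
    IsPSeparable p (zpowers r : Set G) ↔ ∀ g ∉ zpowers r, Separated p r g := by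
  unfold IsPSeparable
  rw [← @isOpen_compl_iff _ _ (proPTopology p G)]
  refine forall₂_congr fun g hg => exists_congr fun N => and_congr_right fun hN => ?_
  have hn := hN.1
  constructor
  · intro h m hm
    have h1 := h (g⁻¹ * r ^ (-m)) ?_
    · simp only [mul_inv_cancel_left, Set.mem_compl_iff, SetLike.mem_coe] at h1
      exact h1 (zpow_mem (mem_zpowers r) _)
    · have : (r ^ m * g)⁻¹ ∈ N := inv_mem hm
      simpa using this
  · intro h n hnN hc
    obtain ⟨m, hm⟩ := mem_zpowers_iff.1 (SetLike.mem_coe.1 hc)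
    refine h (-m) ?_
    rw [zpow_neg, hm]
    simpa using inv_mem hnN

/-- Residual `p`-finiteness is separability of the trivial subgroup, which is `p`-isolated because
the group is torsion-free. -/
theorem IsPCSS.isRootedPCSS (hU : InUpsilon G) (hC : IsPCSS p G) : IsRootedPCSS p G := by
  have hR := hU.isRooted
  refine ⟨hR, fun g hg => ?_, fun r g hr hg => ?_⟩
  · have h := hC (zpowers 1) inferInstance (fun f q hq _ hf => ?_)
    · obtain ⟨N, hN, h⟩ := isPSeparable_zpowers_iff.1 h g (by simpa using hg)
      exact ⟨N, hN, by simpa using h 0⟩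
    · rw [zpowers_one_eq_bot, mem_bot] at hf ⊢
      exact hR.eq_one_of_pow hq.pos hf
  · exact isPSeparable_zpowers_iff.1
      (hC (zpowers r) inferInstance fun f q hq _ hf => hr.mem_of_pow f q hq.pos hf) g hg

/-- Write the generator as `r ^ k` with `r` isolated. Elements outside `⟨r⟩` are separated already
from `⟨r⟩`. Being `p`-isolated forces `k` to be a power of `p`, so the remaining elements `r ^ i`,
`k ∤ i`, are separated by a quotient in which the order of `r` is divisible by `k`. -/
theorem IsRootedPCSS.isPCSS (hp : p.Prime) (hG : IsRootedPCSS p G) : IsPCSS p G := by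
  intro C hC hiso
  obtain ⟨c, rfl⟩ := C.isCyclic_iff_exists_zpowers_eq_top.1 hC
  rw [isPSeparable_zpowers_iff]
  intro g hg
  by_cases hc : c = 1
  · subst hc
    exact hG.isResiduallyP.separated_one (by rintro rfl; exact hg (one_mem _))
  obtain ⟨r, k, hr, hk, rfl⟩ := hG.isRooted.exists_pow_eq hc
  by_cases hgr : g ∈ zpowers r
  · obtain ⟨i, rfl⟩ := mem_zpowers_iff.1 hgr
    have hki : ¬ (k : ℤ) ∣ i := by
      rintro ⟨j, rfl⟩
      exact hg ⟨j, by simp [zpow_mul]⟩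
    -- If `k = q * d` with a prime `q ≠ p`, isolation puts `r ^ d` into `⟨r ^ (q * d)⟩`, which would
    -- make `q` a unit.
    have hkp : k = p ^ k.primeFactorsList.length := by
      refine Nat.eq_prime_pow_of_unique_prime_dvd hk.ne' fun {q} hq hqk => ?_
      by_contra hqp
      obtain ⟨d, rfl⟩ := hqk
      have hd := Nat.pos_of_mul_pos_left hk
      obtain ⟨j, hj⟩ := mem_zpowers_iff.1
        (hiso (r ^ d) q hq hqp (by rw [← pow_mul, mul_comm]; exact mem_zpowers _))
      have : (q * d : ℤ) * j = d := hr.zpow_inj (by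
        rw [zpow_mul]; exact_mod_cast hj)
      have h1 : (d : ℤ) * (q * j) = d * 1 := by linear_combination this
      have h2 := mul_left_cancel₀ (by exact_mod_cast hd.ne') h1
      have h3 : (q : ℤ) ∣ 1 := ⟨j, h2.symm⟩
      exact hq.one_lt.ne' (by exact_mod_cast Int.eq_one_of_dvd_one (by positivity) h3)
    obtain ⟨N, hN, h⟩ := hG.isResiduallyP.exists_dvd hp hr.eq_zero_of_zpow
      k.primeFactorsList.length
    refine ⟨N, hN, fun m hm => hki ?_⟩
    have h1 := h (k * m + i) (by rw [zpow_add, zpow_mul, zpow_natCast]; exact hm)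
    have h2 : (k : ℤ) ∣ k * m + i := by
      conv_lhs => rw [hkp]
      exact_mod_cast h1
    exact (dvd_add_right (dvd_mul_right _ _)).1 h2
  · exact (hG.separatesIsolated r g hr hgr).of_mem_zpowers (pow_mem (mem_zpowers r) _)

theorem IsRootedPCSS.of_mulEquiv {H : Type*} [Group H] (e : G ≃* H) (hG : IsRootedPCSS p G) :
    IsRootedPCSS p H := by
  refine ⟨hG.isRooted.of_mulEquiv e, fun g hg => ?_, fun r g hr hg => ?_⟩
  · obtain ⟨N, hN, h⟩ := hG.isResiduallyP (e.symm g) (by simpa using hg)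
    exact ⟨N.comap e.symm.toMonoidHom, hN.comap _, h⟩
  · refine .of_hom e.symm.toMonoidHom (hG.separatesIsolated _ _ ?_ ?_)
    · exact .of_injective e.toMonoidHom e.injective (by simpa using hr)
    · rintro ⟨m, hm⟩
      exact hg ⟨m, e.symm.injective (by simpa using hm)⟩

theorem isRootedPCSS_of_subsingleton [Subsingleton G] : IsRootedPCSS p G :=
  ⟨isRooted_of_subsingleton, fun g hg => absurd (Subsingleton.elim g 1) hg,
    fun _ g _ hg => absurd (Subsingleton.elim g 1 ▸ one_mem _) hg⟩

theorem IsResiduallyP.prod {H : Type*} [Group H] (hG : IsResiduallyP p G)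
    (hH : IsResiduallyP p H) : IsResiduallyP p (G × H) := by
  rintro ⟨a, b⟩ hab
  by_cases ha : a = 1
  · have hb : b ≠ 1 := fun h => hab (by rw [ha, h]; rfl)
    obtain ⟨N, hN, h⟩ := hH b hb
    exact ⟨N.comap (MonoidHom.snd G H), hN.comap _, h⟩
  · obtain ⟨N, hN, h⟩ := hG a ha
    exact ⟨N.comap (MonoidHom.fst G H), hN.comap _, h⟩

/-- Proportional elements of a free abelian group of rank two, one of which is an isolated
generator. -/
theorem IsIsolatedGenerator.mem_of_proportional {t s : G} (hts : Commute t s) {k l k' l' : ℤ}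
    (hr : IsIsolatedGenerator (t ^ k * s ^ l)) (h : k' * l = k * l') :
    t ^ k' * s ^ l' ∈ zpowers (t ^ k * s ^ l) := by
  have hkl : 0 < Int.gcd k l := by
    rw [Int.gcd_pos_iff]
    by_contra! hc
    exact hr.ne_one (by simp [hc.1, hc.2])
  obtain ⟨a, b, hco, h1, h2⟩ := Int.exists_gcd_one hkl
  generalize hd' : (Int.gcd k l : ℤ) = d at h1 h2
  have hd : d ≠ 0 := by omega
  -- By isolation, the generator's subgroup also contains `t ^ a * s ^ b`, the element with coprime
  -- exponents; it remains to see that `(k', l')` is a multiple of `(a, b)`.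
  have hz : t ^ k * s ^ l = (t ^ a * s ^ b) ^ d := by
    rw [(hts.zpow_zpow a b).mul_zpow, ← zpow_mul, ← zpow_mul, ← h1, ← h2]
  have h3 : k' * b = l' * a := by
    refine mul_right_cancel₀ hd ?_
    rw [mul_assoc, ← h2, h, h1]
    ring
  obtain ⟨c, rfl, rfl⟩ : ∃ c, k' = a * c ∧ l' = b * c := by
    have hco' : IsCoprime a b := Int.isCoprime_iff_gcd_eq_one.2 hco
    by_cases ha : a = 0
    · have hb : b * b = 1 := by
        rw [ha, Int.gcd_zero_left] at hco
        rcases Int.natAbs_eq b with e | e <;> rw [e, hco] <;> norm_num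
      refine ⟨b * l', ?_, by rw [← mul_assoc, hb, one_mul]⟩
      have : k' * (b * b) = 0 := by rw [← mul_assoc, h3, ha]; ring
      rw [ha, zero_mul]
      rwa [hb, mul_one] at this
    · obtain ⟨c, rfl⟩ : a ∣ k' := hco'.dvd_of_dvd_mul_right ⟨l', by rw [h3, mul_comm]⟩
      exact ⟨c, rfl, mul_right_cancel₀ ha (by rw [← h3]; ring)⟩
  rw [zpow_mul, zpow_mul, ← (hts.zpow_zpow a b).mul_zpow]
  exact zpow_mem (hr.mem_of_zpow hd (by rw [← hz]; exact mem_zpowers _)) _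

/-- A projection separates unless both coordinates of `g` are powers of the isolated roots `t`, `s`
of the coordinates of `r`; then everything happens in the rank two group `⟨t⟩ × ⟨s⟩`. Trivial
coordinates of `r` are treated apart. -/
theorem IsRootedPCSS.prod {H : Type*} [Group H] (hp : p.Prime) (hG : IsRootedPCSS p G)
    (hH : IsRootedPCSS p H) : IsRootedPCSS p (G × H) := by
  refine ⟨hG.isRooted.prod hH.isRooted, hG.isResiduallyP.prod hH.isResiduallyP, ?_⟩
  rintro ⟨u, a⟩ ⟨v, b⟩ hr hg
  by_cases hu : u = 1
  · subst hu
    by_cases hv : v = 1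
    · subst hv
      refine .of_hom (MonoidHom.snd G H) (hH.separatesIsolated _ _ ?_ ?_)
      · exact .of_injective (MonoidHom.inr G H) (fun _ _ h => (Prod.ext_iff.1 h).2) hr
      · rintro ⟨m, hm⟩
        exact hg ⟨m, by simpa using hm⟩
    · exact .of_hom (MonoidHom.fst G H) (hG.isResiduallyP.separated_one hv)
  by_cases ha : a = 1
  · subst ha
    by_cases hb : b = 1
    · subst hb
      refine .of_hom (MonoidHom.fst G H) (hG.separatesIsolated _ _ ?_ ?_)
      · exact .of_injective (MonoidHom.inl G H) (fun _ _ h => (Prod.ext_iff.1 h).1) hr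
      · rintro ⟨m, hm⟩
        exact hg ⟨m, by simpa using hm⟩
    · exact .of_hom (MonoidHom.snd G H) (hH.isResiduallyP.separated_one hb)
  obtain ⟨t, ht, hut⟩ := hG.isRooted u hu
  obtain ⟨s, hs, has⟩ := hH.isRooted a ha
  by_cases hv : v ∈ zpowers t
  swap
  · exact .of_hom (MonoidHom.fst G H) ((hG.separatesIsolated t v ht hv).of_mem_zpowers hut)
  by_cases hb : b ∈ zpowers s
  swap
  · exact .of_hom (MonoidHom.snd G H) ((hH.separatesIsolated s b hs hb).of_mem_zpowers has)
  obtain ⟨k, rfl⟩ := mem_zpowers_iff.1 hut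
  obtain ⟨k', rfl⟩ := mem_zpowers_iff.1 hv
  obtain ⟨l, rfl⟩ := mem_zpowers_iff.1 has
  obtain ⟨l', rfl⟩ := mem_zpowers_iff.1 hb
  have hts : Commute ((t, 1) : G × H) (1, s) := by
    rw [commute_iff_eq]; simp
  have e : ∀ i j : ℤ, ((t ^ i, s ^ j) : G × H) = (t, 1) ^ i * (1, s) ^ j := fun i j => by simp
  rw [e] at hr
  rw [e, e] at hg ⊢
  refine separated_of_rank_two hp (hG.isResiduallyP.prod hH.isResiduallyP) hH.isResiduallyP
    (MonoidHom.snd G H) hts rfl (fun m hm => ht.eq_zero_of_zpow m (by simpa using hm))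
    (fun m hm => hs.eq_zero_of_zpow m hm) fun h => hg (hr.mem_of_proportional hts h)

end Separation

open Subgroup Monoid

/-! ### Normal forms, centralizers and roots in free products. -/

section FreeProduct

variable {ι : Type*} {G : ι → Type*} [∀ i, Group (G i)]

/-- The element of a free product represented by a list of letters. -/
def listProd (l : List (Σ i, G i)) : CoprodI G :=
  (l.map fun s => CoprodI.of s.2).prod

/-- A list of letters is reduced if it has no trivial letter and neighbours come from different
factors. -/
def IsReduced (l : List (Σ i, G i)) : Prop :=
  (∀ s ∈ l, s.2 ≠ 1) ∧ l.IsChain fun a b => a.1 ≠ b.1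

@[simp] theorem listProd_nil : listProd ([] : List (Σ i, G i)) = 1 := rfl

@[simp] theorem listProd_cons (s : Σ i, G i) (l : List (Σ i, G i)) :
    listProd (s :: l) = CoprodI.of s.2 * listProd l := by simp [listProd]

@[simp] theorem listProd_append (l m : List (Σ i, G i)) :
    listProd (l ++ m) = listProd l * listProd m := by simp [listProd]

theorem exists_isReduced (x : CoprodI G) : ∃ l, IsReduced l ∧ listProd l = x := by
  classical
  exact ⟨(CoprodI.Word.equiv x).toList, ⟨(CoprodI.Word.equiv x).ne_one,
    (CoprodI.Word.equiv x).chain_ne⟩, CoprodI.Word.equiv.symm_apply_apply x⟩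

theorem IsReduced.eq_of_listProd_eq {l m : List (Σ i, G i)} (hl : IsReduced l) (hm : IsReduced m)
    (h : listProd l = listProd m) : l = m := by
  classical
  have := CoprodI.Word.equiv.symm.injective (a₁ := ⟨l, hl.1, hl.2⟩) (a₂ := ⟨m, hm.1, hm.2⟩) h
  exact congrArg CoprodI.Word.toList this

theorem IsReduced.length_eq {l m : List (Σ i, G i)} (hl : IsReduced l) (hm : IsReduced m)
    (h : listProd l = listProd m) : l.length = m.length := by
  rw [hl.eq_of_listProd_eq hm h]

theorem isReduced_nil : IsReduced ([] : List (Σ i, G i)) := ⟨by simp, by simp⟩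

theorem isReduced_singleton {s : Σ i, G i} (hs : s.2 ≠ 1) : IsReduced [s] :=
  ⟨by simpa using hs, by simp⟩

theorem isReduced_append {l m : List (Σ i, G i)} : IsReduced (l ++ m) ↔ IsReduced l ∧
    IsReduced m ∧ ∀ a ∈ l.getLast?, ∀ b ∈ m.head?, a.1 ≠ b.1 := by
  simp only [IsReduced, List.isChain_append, List.mem_append, or_imp, forall_and]
  tauto

theorem isReduced_cons {s : Σ i, G i} {l : List (Σ i, G i)} : IsReduced (s :: l) ↔
    s.2 ≠ 1 ∧ IsReduced l ∧ ∀ b ∈ l.head?, s.1 ≠ b.1 := by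
  rw [← List.singleton_append, isReduced_append]
  refine and_congr ⟨fun h => h.1 s (by simp), isReduced_singleton⟩ (and_congr_right fun _ => ?_)
  simp

theorem IsReduced.append_overlap {l m n : List (Σ i, G i)} (h : IsReduced (l ++ m))
    (h' : IsReduced (m ++ n)) (hm : m ≠ []) : IsReduced (l ++ m ++ n) :=
  ⟨by
    intro s hs
    rcases List.mem_append.1 hs with hs | hs
    · exact h.1 s hs
    · exact h'.1 s (List.mem_append_right _ hs), List.IsChain.append_overlap h.2 h'.2 hm⟩

/-- The list of letters representing the inverse. -/
def invList (l : List (Σ i, G i)) : List (Σ i, G i) :=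
  (l.map fun s => ⟨s.1, s.2⁻¹⟩).reverse

theorem invList_append (l m : List (Σ i, G i)) : invList (l ++ m) = invList m ++ invList l := by
  simp [invList]

theorem invList_invList (l : List (Σ i, G i)) : invList (invList l) = l := by
  simp [invList, Function.comp_def]

theorem listProd_invList (l : List (Σ i, G i)) : listProd (invList l) = (listProd l)⁻¹ := by
  induction l with
  | nil => simp [invList]
  | cons a l ih =>
    rw [← List.singleton_append, invList_append, listProd_append, ih]
    simp [invList]

theorem IsReduced.invList {l : List (Σ i, G i)} (h : IsReduced l) : IsReduced (invList l) := by
  refine ⟨?_, ?_⟩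
  · intro s hs
    obtain ⟨t, ht, rfl⟩ := List.mem_map.1 (List.mem_reverse.1 hs)
    simpa using h.1 t ht
  · rw [ProPGraph.invList, List.isChain_reverse, List.isChain_map]
    exact h.2.imp fun a b hab => hab.symm

theorem head?_invList (l : List (Σ i, G i)) :
    (invList l).head? = l.getLast?.map fun s => ⟨s.1, s.2⁻¹⟩ := by
  simp [invList]

theorem getLast?_invList (l : List (Σ i, G i)) :
    (invList l).getLast? = l.head?.map fun s => ⟨s.1, s.2⁻¹⟩ := by
  simp [invList]

/-- A nonempty list is cyclically reduced if its square is reduced. -/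
def IsCyclicallyReduced (l : List (Σ i, G i)) : Prop := l ≠ [] ∧ IsReduced (l ++ l)

theorem IsCyclicallyReduced.isReduced {l : List (Σ i, G i)} (h : IsCyclicallyReduced l) :
    IsReduced l := (isReduced_append.1 h.2).1

theorem listProd_flatten_replicate (l : List (Σ i, G i)) (n : ℕ) :
    listProd (List.replicate n l).flatten = listProd l ^ n := by
  induction n with
  | zero => simp
  | succ n ih => rw [List.replicate_succ, List.flatten_cons, listProd_append, ih, pow_succ']

theorem IsCyclicallyReduced.isReduced_append_flatten {l : List (Σ i, G i)}
    (h : IsCyclicallyReduced l) (n : ℕ) : IsReduced (l ++ (List.replicate n l).flatten) := by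
  induction n with
  | zero => simpa using h.isReduced
  | succ n ih =>
    rw [List.replicate_succ, List.flatten_cons, ← List.append_assoc]
    exact h.2.append_overlap ih h.1

theorem IsCyclicallyReduced.flatten {l : List (Σ i, G i)} (h : IsCyclicallyReduced l) {n : ℕ}
    (hn : 0 < n) : IsCyclicallyReduced (List.replicate n l).flatten := by
  obtain ⟨n, rfl⟩ := Nat.exists_eq_add_one.2 hn
  refine ⟨fun e => h.1 ?_, ?_⟩
  · rw [List.replicate_succ, List.flatten_cons, List.append_eq_nil_iff] at e
    exact e.1
  · rw [← List.flatten_append, ← List.replicate_add, show n + 1 + (n + 1) = n + (n + 1) + 1 by omega,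
      List.replicate_succ, List.flatten_cons]
    exact h.isReduced_append_flatten _

theorem IsCyclicallyReduced.listProd_ne_one {l : List (Σ i, G i)} (h : IsCyclicallyReduced l) :
    listProd l ≠ 1 := fun e =>
  h.1 (h.isReduced.eq_of_listProd_eq isReduced_nil (by simpa using e))

theorem IsCyclicallyReduced.pow_ne_one {l : List (Σ i, G i)} (h : IsCyclicallyReduced l) {n : ℕ}
    (hn : 0 < n) : listProd l ^ n ≠ 1 := by
  rw [← listProd_flatten_replicate]
  exact (h.flatten hn).listProd_ne_one

/-- Lists commuting with a fixed nonempty list are the powers of a single list. -/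
theorem exists_root_of_append_comm {α : Type*} {l : List α} (hl : l ≠ []) :
    ∃ w : List α, w ++ l = l ++ w ∧
      ∀ v : List α, v ++ l = l ++ v → ∃ k : ℕ, v = (List.replicate k w).flatten := by
  classical
  -- The root is a shortest nonempty list commuting with `l`.
  have hex : ∃ n, ∃ w : List α, w ≠ [] ∧ w ++ l = l ++ w ∧ w.length = n := ⟨_, l, hl, rfl, rfl⟩
  obtain ⟨w, hw0, hwl, hwn⟩ := Nat.find_spec hex
  have hpow : ∀ (v : List α) (n : ℕ), v ++ l = l ++ v →
      v ++ (List.replicate n l).flatten = (List.replicate n l).flatten ++ v := by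
    intro v n h
    induction n with
    | zero => simp
    | succ n ih =>
      rw [List.replicate_succ, List.flatten_cons, ← List.append_assoc, h, List.append_assoc, ih,
        List.append_assoc]
  -- All lists commuting with `l` are prefixes of powers of `l`, hence comparable; this permits
  -- division with remainder by the shortest one.
  have hprefix : ∀ (v : List α) (n : ℕ), v ++ l = l ++ v → v.length ≤ n →
      v <+: (List.replicate n l).flatten := by
    intro v n h hn
    refine List.prefix_of_prefix_length_le (List.prefix_append v _)
      (hpow v n h ▸ List.prefix_append _ v) ?_
    have : 1 ≤ l.length := List.length_pos_iff.2 hl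
    simp only [List.length_flatten, List.map_replicate, List.sum_replicate, smul_eq_mul]
    nlinarith
  refine ⟨w, hwl, fun v => ?_⟩
  induction hlen : v.length using Nat.strong_induction_on generalizing v with
  | _ n ih =>
    intro hv
    by_cases hv0 : v = []
    · exact ⟨0, by simpa using hv0⟩
    have hle : w.length ≤ v.length := by
      rw [hwn]
      exact Nat.find_min' hex ⟨v, hv0, hv, rfl⟩
    obtain ⟨v', rfl⟩ := List.prefix_of_prefix_length_le (hprefix w v.length hwl hle)
      (hprefix v v.length hv le_rfl) hle
    have hw1 : 0 < w.length := List.length_pos_iff.2 hw0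
    rw [List.length_append] at hlen
    obtain ⟨k, hk⟩ := ih v'.length (by omega) v' rfl (by
      rw [← List.append_assoc, ← hwl, List.append_assoc, List.append_assoc] at hv
      exact List.append_cancel_left hv)
    exact ⟨k + 1, by rw [List.replicate_succ, List.flatten_cons, ← hk]⟩

/-- Reduced lists representing an element that commutes with a cyclically reduced one commute with
it as lists, up to inversion. -/
theorem IsCyclicallyReduced.append_comm {l m : List (Σ i, G i)} (hl : IsCyclicallyReduced l)
    (hm : IsReduced m) (h : Commute (listProd m) (listProd l)) :
    m ++ l = l ++ m ∨ invList m ++ l = l ++ invList m := by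
  by_cases hm0 : m = []
  · simp [hm0]
  obtain ⟨a, ha⟩ : ∃ a, l.head? = some a := Option.ne_none_iff_exists'.1 (by simpa using hl.1)
  obtain ⟨b, hb⟩ : ∃ b, l.getLast? = some b := Option.ne_none_iff_exists'.1 (by simpa using hl.1)
  obtain ⟨c, hc⟩ : ∃ c, m.head? = some c := Option.ne_none_iff_exists'.1 (by simpa using hm0)
  obtain ⟨d, hd⟩ : ∃ d, m.getLast? = some d := Option.ne_none_iff_exists'.1 (by simpa using hm0)
  have hba : b.1 ≠ a.1 := (isReduced_append.1 hl.2).2.2 b (by simp [hb]) a (by simp [ha])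
  have hml : d.1 ≠ a.1 → IsReduced (m ++ l) := fun h =>
    isReduced_append.2 ⟨hm, hl.isReduced, by simpa [ha, hd] using h⟩
  have hlm : b.1 ≠ c.1 → IsReduced (l ++ m) := fun h =>
    isReduced_append.2 ⟨hl.isReduced, hm, by simpa [hb, hc] using h⟩
  have hml' : d.1 ≠ b.1 → IsReduced (m ++ invList l) := fun h =>
    isReduced_append.2 ⟨hm, hl.isReduced.invList, by simpa [head?_invList, hb, hd] using h⟩
  have hlm' : a.1 ≠ c.1 → IsReduced (invList l ++ m) := fun h =>
    isReduced_append.2 ⟨hl.isReduced.invList, hm, by simpa [getLast?_invList, ha, hc] using h⟩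
  have hl1 : 0 < l.length := List.length_pos_iff.2 hl.1
  -- As `a` and `b` lie in different factors, at each end of `m` at least one of `l`, `l⁻¹` can be
  -- attached without cancellation. If the same one fits at both ends, uniqueness of reduced forms
  -- gives commutation of lists. Otherwise a conjugate of `m` by `l` or `l⁻¹` is reduced, equal to
  -- `m` and longer than `m`.
  by_cases h1 : d.1 = a.1 <;> by_cases h2 : b.1 = c.1
  · right
    have := (hml' (h1 ▸ hba.symm)).eq_of_listProd_eq (hlm' (h2 ▸ hba.symm)) (by
      rw [listProd_append, listProd_append, listProd_invList]
      exact h.inv_right.eq)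
    have := congrArg invList this
    rw [invList_append, invList_append, invList_invList] at this
    exact this.symm
  · exfalso
    have := ((hlm h2).append_overlap (hml' (h1 ▸ hba.symm)) hm0).length_eq hm (by
      rw [listProd_append, listProd_append, listProd_invList, ← h.eq, mul_inv_cancel_right])
    rw [List.length_append, List.length_append] at this
    omega
  · exfalso
    have := ((hlm' (h2 ▸ hba.symm)).append_overlap (hml h1) hm0).length_eq hm (by
      rw [listProd_append, listProd_append, listProd_invList, mul_assoc, h.eq,
        inv_mul_cancel_left])
    rw [List.length_append, List.length_append] at this
    omega
  · left
    exact (hml h1).eq_of_listProd_eq (hlm h2) (by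
      rw [listProd_append, listProd_append]; exact h.eq)

/-- The centralizer of a cyclically reduced element is cyclic. -/
theorem IsCyclicallyReduced.exists_centralizer {l : List (Σ i, G i)}
    (hl : IsCyclicallyReduced l) : ∃ w : CoprodI G, Commute w (listProd l) ∧
      ∀ x : CoprodI G, Commute x (listProd l) → x ∈ zpowers w := by
  obtain ⟨w, hw, hroot⟩ := exists_root_of_append_comm hl.1
  refine ⟨listProd w, ?_, fun x hx => ?_⟩
  · rw [commute_iff_eq, ← listProd_append, hw, listProd_append]
  obtain ⟨m, hm, rfl⟩ := exists_isReduced x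
  rcases hl.append_comm hm hx with h | h
  · obtain ⟨k, rfl⟩ := hroot m h
    rw [listProd_flatten_replicate]
    exact pow_mem (mem_zpowers _) _
  · obtain ⟨k, hk⟩ := hroot _ h
    rw [← inv_mem_iff, ← listProd_invList, hk, listProd_flatten_replicate]
    exact pow_mem (mem_zpowers _) _

/-- Every element of a free product is conjugate to a cyclically reduced one, or into a factor. -/
theorem exists_conj_cyclicallyReduced (x : CoprodI G) : x = 1 ∨
    (∃ (i : ι) (c : CoprodI G) (u : G i), u ≠ 1 ∧ x = c * CoprodI.of u * c⁻¹) ∨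
    ∃ (c : CoprodI G) (l : List (Σ i, G i)), IsCyclicallyReduced l ∧
      x = c * listProd l * c⁻¹ := by
  obtain ⟨l, hl, rfl⟩ := exists_isReduced x
  suffices H : ∀ (n : ℕ) (l : List (Σ i, G i)), l.length = n → IsReduced l → ∀ c : CoprodI G,
      c * listProd l * c⁻¹ = 1 ∨
      (∃ (i : ι) (d : CoprodI G) (u : G i), u ≠ 1 ∧
        c * listProd l * c⁻¹ = d * CoprodI.of u * d⁻¹) ∨
      ∃ (d : CoprodI G) (m : List (Σ i, G i)), IsCyclicallyReduced m ∧
        c * listProd l * c⁻¹ = d * listProd m * d⁻¹ by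
    simpa using H _ l rfl hl 1
  intro n
  induction n using Nat.strong_induction_on with
  | _ n ih =>
    intro l hn hl c
    rcases l with - | ⟨a, l⟩
    · left; simp
    rcases List.eq_nil_or_concat l with rfl | ⟨m, b, rfl⟩
    · right; left
      exact ⟨a.1, c, a.2, hl.1 a (by simp), by simp⟩
    rw [List.concat_eq_append] at hl hn ⊢
    -- If the two end letters share a factor, conjugation merges the last letter into the first and
    -- shortens the list, by two when they cancel; otherwise the list is cyclically reduced.
    by_cases hab : b.1 = a.1
    · obtain ⟨i, u⟩ := a
      obtain ⟨j, v⟩ := b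
      obtain rfl : j = i := hab
      have hm : IsReduced m := (isReduced_append.1 (isReduced_cons.1 hl).2.1).1
      simp only [List.length_cons, List.length_append, List.length_nil] at hn
      by_cases hvu : v * u = 1
      · have e : c * listProd (⟨j, u⟩ :: (m ++ [⟨j, v⟩])) * c⁻¹ =
            c * (CoprodI.of v)⁻¹ * listProd m * (c * (CoprodI.of v)⁻¹)⁻¹ := by
          simp only [listProd_cons, listProd_append, listProd_nil, eq_inv_of_mul_eq_one_right hvu,
            map_inv]
          group
        rw [e]
        exact ih m.length (by omega) m rfl hm (c * (CoprodI.of v)⁻¹)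
      · have hred : IsReduced (⟨j, v * u⟩ :: m) := by
          rw [← List.cons_append] at hl
          have h2 := isReduced_cons.1 (isReduced_append.1 hl).1
          exact isReduced_cons.2 ⟨hvu, h2.2.1, h2.2.2⟩
        have e : c * listProd (⟨j, u⟩ :: (m ++ [⟨j, v⟩])) * c⁻¹ =
            c * (CoprodI.of v)⁻¹ * listProd (⟨j, v * u⟩ :: m) * (c * (CoprodI.of v)⁻¹)⁻¹ := by
          simp only [listProd_cons, listProd_append, listProd_nil, map_mul]
          group
        rw [e]
        exact ih (m.length + 1) (by omega) _ (by simp) hred (c * (CoprodI.of v)⁻¹)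
    · right; right
      refine ⟨c, _, ⟨by simp, isReduced_append.2 ⟨hl, hl, ?_⟩⟩, rfl⟩
      simpa [List.getLast?_cons] using hab

/-- Splitting off the outer letters from factor `i` leaves a middle `m` that can be multiplied by
nontrivial elements of that factor on either side and stay reduced. -/
theorem exists_eq_of_mul_listProd_mul_of (i : ι) (x : CoprodI G) :
    ∃ (u v : G i) (m : List (Σ i, G i)), IsReduced m ∧ (∀ a ∈ m.head?, i ≠ a.1) ∧
      (∀ a ∈ m.getLast?, a.1 ≠ i) ∧ x = CoprodI.of u * listProd m * CoprodI.of v := by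
  obtain ⟨l, hl, rfl⟩ := exists_isReduced x
  obtain ⟨u, m, hm, hmi, e⟩ : ∃ (u : G i) (m : List (Σ i, G i)), IsReduced m ∧
      (∀ a ∈ m.head?, i ≠ a.1) ∧ listProd l = CoprodI.of u * listProd m := by
    rcases l with - | ⟨⟨j, u⟩, l⟩
    · exact ⟨1, [], isReduced_nil, by simp, by simp⟩
    by_cases hj : i = j
    · subst hj
      exact ⟨u, l, (isReduced_cons.1 hl).2.1, (isReduced_cons.1 hl).2.2, by simp⟩
    · exact ⟨1, _, hl, by simpa using hj, by simp⟩
  rw [e]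
  rcases List.eq_nil_or_concat m with rfl | ⟨n, ⟨j, v⟩, rfl⟩
  · exact ⟨u, 1, [], isReduced_nil, by simp, by simp, by simp⟩
  rw [List.concat_eq_append] at hm hmi ⊢
  by_cases hj : j = i
  · subst hj
    have h := isReduced_append.1 hm
    refine ⟨u, v, n, h.1, fun a ha => hmi a ?_, fun a ha => h.2.2 a ha _ rfl, by
      simp [mul_assoc]⟩
    rw [List.head?_append, Option.mem_def.1 ha]
    rfl
  · exact ⟨u, 1, _, hm, hmi, by simpa using hj, by simp⟩

/-- Factors of a free product are malnormal. -/
theorem mem_range_of_of_conj {i : ι} {x : CoprodI G} {b b' : G i} (hb : b ≠ 1)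
    (h : CoprodI.of b * x = x * CoprodI.of b') : ∃ u : G i, x = CoprodI.of u := by
  obtain ⟨u, v, m, hm, hm1, hm2, rfl⟩ := exists_eq_of_mul_listProd_mul_of i x
  by_cases hm0 : m = []
  · exact ⟨u * v, by simp [hm0]⟩
  exfalso
  have hb1 : u⁻¹ * b * u ≠ 1 := fun e => hb (by
    rw [mul_assoc, inv_mul_eq_one] at e
    simpa using e.symm)
  have e1 : CoprodI.of (u⁻¹ * b * u) * listProd m = listProd m * CoprodI.of (v * b' * v⁻¹) := by
    simp only [map_mul, map_inv]
    calc _ = (CoprodI.of u)⁻¹ * (CoprodI.of b * (CoprodI.of u * listProd m * CoprodI.of v)) *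
          (CoprodI.of v)⁻¹ := by group
      _ = _ := by rw [h]; group
  have hb2 : v * b' * v⁻¹ ≠ 1 := fun e => hb1 (by
    rw [e, map_one, mul_one, mul_eq_right] at e1
    exact CoprodI.of_injective i (by rw [e1, map_one]))
  have r1 : IsReduced (⟨i, u⁻¹ * b * u⟩ :: m) := isReduced_cons.2 ⟨hb1, hm, hm1⟩
  have r2 : IsReduced (m ++ [⟨i, v * b' * v⁻¹⟩]) :=
    isReduced_append.2 ⟨hm, isReduced_singleton hb2, by simpa using hm2⟩
  -- One of these equal lists begins in factor `i`, the other with the head of `m`, which lies in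
  -- another factor.
  have e2 := r1.eq_of_listProd_eq r2 (by simpa using e1)
  rcases m with - | ⟨a, m⟩
  · exact hm0 rfl
  · rw [List.cons_append, List.cons.injEq] at e2
    exact hm1 a rfl (by rw [← e2.1])

/-- Commuting elements of a free product lie in a common cyclic subgroup or in a common conjugate
of a factor. -/
theorem commute_cases {x y : CoprodI G} (h : Commute x y) :
    (∃ t : CoprodI G, x ∈ zpowers t ∧ y ∈ zpowers t) ∨
    ∃ (i : ι) (c : CoprodI G) (u v : G i), x = c * CoprodI.of u * c⁻¹ ∧
      y = c * CoprodI.of v * c⁻¹ := by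
  rcases exists_conj_cyclicallyReduced x with rfl | ⟨i, c, u, hu, rfl⟩ | ⟨c, l, hl, rfl⟩
  · exact Or.inl ⟨y, one_mem _, mem_zpowers y⟩
  · right
    obtain ⟨v, hv⟩ := mem_range_of_of_conj (x := c⁻¹ * y * c) (b' := u) hu (by
      have := h.eq
      calc _ = c⁻¹ * ((c * CoprodI.of u * c⁻¹) * y) * c := by group
        _ = _ := by rw [this]; group)
    exact ⟨i, c, u, v, rfl, by rw [← hv]; group⟩
  · left
    obtain ⟨w, hw, hcen⟩ := hl.exists_centralizer
    have key : ∀ z ∈ zpowers w, c * z * c⁻¹ ∈ zpowers (c * w * c⁻¹) := by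
      rintro _ ⟨k, rfl⟩
      exact ⟨k, by simp⟩
    refine ⟨c * w * c⁻¹, key _ (hcen _ (Commute.refl _)), ?_⟩
    have h1 := key (c⁻¹ * y * c) (hcen _ (by
      have := h.eq
      show _ = _
      calc _ = c⁻¹ * (y * (c * listProd l * c⁻¹)) * c := by group
        _ = _ := by rw [← this]; group))
    simpa [mul_assoc] using h1

theorem coprodI_eq_one_of_pow (hG : ∀ i, IsRooted (G i)) {x : CoprodI G} {n : ℕ} (hn : 0 < n)
    (hx : x ^ n = 1) : x = 1 := by
  rcases exists_conj_cyclicallyReduced x with h | ⟨i, c, u, hu, rfl⟩ | ⟨c, l, hl, rfl⟩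
  · exact h
  · rw [conj_pow, ← map_pow, conj_eq_one_iff] at hx
    exact absurd ((hG i).eq_one_of_pow hn (CoprodI.of_injective i (by rw [hx, map_one]))) hu
  · rw [conj_pow, conj_eq_one_iff] at hx
    exact absurd hx (hl.pow_ne_one hn)

theorem coprodI_eq_zero_of_zpow (hG : ∀ i, IsRooted (G i)) {x : CoprodI G} (hx : x ≠ 1) {m : ℤ}
    (h : x ^ m = 1) : m = 0 := by
  by_contra hm
  refine hx (coprodI_eq_one_of_pow hG (n := m.natAbs) (by omega) ?_)
  rcases Int.natAbs_eq m with e | e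
  · rw [e] at h
    exact_mod_cast h
  · rw [e, zpow_neg, inv_eq_one] at h
    exact_mod_cast h

/-- A root `x` of a nontrivial element of the factor commutes with that element, so malnormality
places `x` in the factor, where `t` is isolated. -/
theorem isIsolatedGenerator_of (hG : ∀ i, IsRooted (G i)) {i : ι} {t : G i}
    (ht : IsIsolatedGenerator t) : IsIsolatedGenerator (CoprodI.of t : CoprodI G) := by
  have h0 : ∀ m : ℤ, (CoprodI.of t : CoprodI G) ^ m = 1 → m = 0 := fun m hm =>
    ht.eq_zero_of_zpow m (CoprodI.of_injective i (by rw [map_zpow, hm, map_one]))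
  refine ⟨h0, fun x n hn hx => ?_⟩
  obtain ⟨m, hm⟩ := mem_zpowers_iff.1 hx
  by_cases hm0 : m = 0
  · rw [hm0, zpow_zero] at hm
    rw [coprodI_eq_one_of_pow hG hn hm.symm]
    exact one_mem _
  rw [← map_zpow] at hm
  obtain ⟨u, rfl⟩ := mem_range_of_of_conj (x := x) (b := t ^ m) (b' := t ^ m)
    (fun e => hm0 (ht.eq_zero_of_zpow m e)) (by rw [hm]; exact (Commute.pow_self x n).eq)
  rw [← map_pow] at hm
  obtain ⟨k, rfl⟩ := mem_zpowers_iff.1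
    (ht.mem_of_pow u n hn ⟨m, CoprodI.of_injective i hm⟩)
  exact ⟨k, by simp⟩

/-- The generator `w` of the centralizer of `l` works. A nontrivial root `x` of a power of `w`
commutes with a power of `l`, which is again cyclically reduced up to inversion; its cyclic
centralizer contains both `x` and `l`, so `x` commutes with `l` itself. -/
theorem IsCyclicallyReduced.exists_isIsolatedGenerator (hG : ∀ i, IsRooted (G i))
    {l : List (Σ i, G i)} (hl : IsCyclicallyReduced l) :
    ∃ w : CoprodI G, IsIsolatedGenerator w ∧ listProd l ∈ zpowers w := by
  obtain ⟨w, hw, hcen⟩ := hl.exists_centralizer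
  have hlw := hcen _ (Commute.refl _)
  obtain ⟨k, hk⟩ := mem_zpowers_iff.1 hlw
  have hk0 : k ≠ 0 := by
    rintro rfl
    exact hl.listProd_ne_one (by simpa using hk.symm)
  have hw1 : w ≠ 1 := by
    rintro rfl
    exact hl.listProd_ne_one (by simpa using hk.symm)
  refine ⟨w, ⟨fun m hm => coprodI_eq_zero_of_zpow hG hw1 hm, fun x n hn hx => ?_⟩, hlw⟩
  obtain ⟨j, hj⟩ := mem_zpowers_iff.1 hx
  by_cases hj0 : j = 0
  · rw [hj0, zpow_zero] at hj
    rw [coprodI_eq_one_of_pow hG hn hj.symm]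
    exact one_mem _
  have h1 : Commute x (listProd l ^ j) := by
    rw [← hk, ← zpow_mul, mul_comm, zpow_mul, hj]
    exact ((Commute.refl x).pow_right n).zpow_right k
  have h2 : Commute x (listProd (List.replicate j.natAbs l).flatten) := by
    rw [listProd_flatten_replicate]
    rcases Int.natAbs_eq j with e | e
    · rw [e] at h1
      exact_mod_cast h1
    · rw [e, zpow_neg, Commute.inv_right_iff] at h1
      exact_mod_cast h1
  obtain ⟨w', -, hcen'⟩ := (hl.flatten (n := j.natAbs) (by omega)).exists_centralizer
  obtain ⟨a, rfl⟩ := mem_zpowers_iff.1 (hcen' x h2)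
  obtain ⟨b, hb⟩ := mem_zpowers_iff.1 (hcen' (listProd l) (by
    rw [listProd_flatten_replicate]
    exact (Commute.refl _).pow_right _))
  refine hcen _ ?_
  rw [← hb]
  exact (Commute.refl w').zpow_zpow a b

theorem isRooted_coprodI (hG : ∀ i, IsRooted (G i)) : IsRooted (CoprodI G) := by
  intro g hg
  have key : ∀ (c r x : CoprodI G), IsIsolatedGenerator r → x ∈ zpowers r →
      ∃ r', IsIsolatedGenerator r' ∧ c * x * c⁻¹ ∈ zpowers r' := by
    rintro c r _ hr ⟨k, rfl⟩
    exact ⟨_, hr.conj c, k, by simp⟩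
  rcases exists_conj_cyclicallyReduced g with h | ⟨i, c, u, hu, rfl⟩ | ⟨c, l, hl, rfl⟩
  · exact absurd h hg
  · obtain ⟨t, ht, k, rfl⟩ := hG i u hu
    exact key c _ _ (isIsolatedGenerator_of hG ht) ⟨k, by simp⟩
  · obtain ⟨w, hw, hlw⟩ := hl.exists_isIsolatedGenerator hG
    exact key c w _ hw hlw

end FreeProduct

/-! ### Free products of copies of a finite `p`-group act by triangular transformations. -/

section ResidualFreeProduct

variable {p n : ℕ} {J T : Type*} [Group T]

/-- The translation action of `Fin n → T` on functions. -/
def translate (p : ℕ) (τ : Fin n → T) (a : (Fin n → T) → ZMod p) : (Fin n → T) → ZMod p :=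
  fun x => a (τ⁻¹ * x)

@[simp] theorem translate_one (a : (Fin n → T) → ZMod p) : translate p 1 a = a := by
  funext x; simp [translate]

theorem translate_mul (σ τ : Fin n → T) (a : (Fin n → T) → ZMod p) :
    translate p (σ * τ) a = translate p σ (translate p τ a) := by
  funext x; simp [translate, mul_assoc]

theorem translate_add (τ : Fin n → T) (a b : (Fin n → T) → ZMod p) :
    translate p τ (a + b) = translate p τ a + translate p τ b := rfl

/-- Column vectors with entries in the functions on `Fin n → T`, on which a unitriangular version
of the free product acts. -/
abbrev PathModule (p n : ℕ) (T : Type*) : Type _ := Fin (n + 1) → (Fin n → T) → ZMod p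

open Classical in
/-- The component of `t` along the edges of colour `j` of a path with edges coloured by `c`. -/
noncomputable def edgeElement (c : Fin n → J) (j : J) (t : T) (i : Fin n) : Fin n → T :=
  if c i = j then Pi.mulSingle i t else 1

theorem edgeElement_mul (c : Fin n → J) (j : J) (s t : T) (i : Fin n) :
    edgeElement c j (s * t) i = edgeElement c j s i * edgeElement c j t i := by
  unfold edgeElement
  split_ifs
  · exact Pi.mulSingle_mul (f := fun _ => T) i s t
  · simp

theorem edgeElement_one (c : Fin n → J) (j : J) (i : Fin n) :
    edgeElement c j (1 : T) i = 1 := by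
  unfold edgeElement
  split_ifs <;> simp

/-- The action of `t` in the factor of colour `j` on column vectors: along each edge of colour `j`
of the path, it is given by the matrix with rows `(t, t - 1)` and `(0, 1)`. -/
noncomputable def pathAct (p : ℕ) (c : Fin n → J) (j : J) (t : T) (v : PathModule p n T) :
    PathModule p n T :=
  Fin.snoc (α := fun _ => (Fin n → T) → ZMod p)
    (fun i => translate p (edgeElement c j t i) (v i.castSucc + v i.succ) - v i.succ)
    (v (Fin.last n))

@[simp] theorem pathAct_castSucc (c : Fin n → J) (j : J) (t : T) (v : PathModule p n T)
    (i : Fin n) : pathAct p c j t v i.castSucc =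
      translate p (edgeElement c j t i) (v i.castSucc + v i.succ) - v i.succ := by
  simp [pathAct]

@[simp] theorem pathAct_last (c : Fin n → J) (j : J) (t : T) (v : PathModule p n T) :
    pathAct p c j t v (Fin.last n) = v (Fin.last n) := by
  simp [pathAct]

theorem pathAct_one (c : Fin n → J) (j : J) (v : PathModule p n T) :
    pathAct p c j 1 v = v := by
  funext k
  induction k using Fin.lastCases with
  | last => simp
  | cast i => simp [edgeElement_one]

theorem pathAct_of_ne (c : Fin n → J) (j : J) (t : T) (v : PathModule p n T) (i : Fin n)
    (h : c i ≠ j) : pathAct p c j t v i.castSucc = v i.castSucc := by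
  simp [edgeElement, h]

/-- Neighbouring edges have different colours, so the entry below an edge of colour `j` is fixed by
factor `j`. On each such edge the action is then that of the matrices with rows `(t, t - 1)`, `(0,
1)`, which multiply as `t` does. -/
theorem pathAct_mul (c : Fin n → J)
    (hc : ∀ i j : Fin n, (j : ℕ) = i + 1 → c i ≠ c j) (j : J) (s t : T) (v : PathModule p n T) :
    pathAct p c j (s * t) v = pathAct p c j s (pathAct p c j t v) := by
  funext k
  induction k using Fin.lastCases with
  | last => simp
  | cast i =>
    by_cases hi : c i = j
    · have hs : pathAct p c j t v i.succ = v i.succ := by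
        induction h : i.succ using Fin.lastCases with
        | last => simp
        | cast k =>
          refine pathAct_of_ne c j t v k fun e => hc i k ?_ (hi.trans e.symm)
          have := congrArg Fin.val h
          simpa using this.symm
      rw [pathAct_castSucc, pathAct_castSucc c j s, pathAct_castSucc c j t, hs, edgeElement_mul,
        translate_mul]
      simp
    · rw [pathAct_of_ne _ _ _ _ _ hi, pathAct_of_ne _ _ _ _ _ hi, pathAct_of_ne _ _ _ _ _ hi]

/-- The action of the free product of copies of `T` on column vectors. -/
noncomputable def pathHom (p : ℕ) (T : Type*) [Group T] (c : Fin n → J)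
    (hc : ∀ i j : Fin n, (j : ℕ) = i + 1 → c i ≠ c j) :
    (CoprodI fun _ : J => T) →* Equiv.Perm (PathModule p n T) :=
  CoprodI.lift fun j => MonoidHom.toHomPerm
    { toFun := pathAct p c j
      map_one' := funext (pathAct_one c j)
      map_mul' := fun s t => funext (pathAct_mul c hc j s t) }

@[simp] theorem pathHom_of (c : Fin n → J)
    (hc : ∀ i j : Fin n, (j : ℕ) = i + 1 → c i ≠ c j) (j : J) (t : T) (v : PathModule p n T) :
    pathHom p T c hc (CoprodI.of (i := j) t) v = pathAct p c j t v := by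
  simp only [pathHom, CoprodI.lift_of]
  rfl

/-- The function depends only on the entries below the `i`-th one. -/
def DependsAbove (i : Fin (n + 1)) (f : PathModule p n T → (Fin n → T) → ZMod p) : Prop :=
  ∀ v w : PathModule p n T, (∀ k, i < k → v k = w k) → f v = f w

/-- Triangular transformations, with translations on the diagonal. -/
def IsTriangular (g : Equiv.Perm (PathModule p n T)) : Prop :=
  ∀ i, ∃ (τ : Fin n → T) (f : PathModule p n T → (Fin n → T) → ZMod p), DependsAbove i f ∧
    ∀ v, g v i = translate p τ (v i) + f v

theorem isTriangular_one : IsTriangular (1 : Equiv.Perm (PathModule p n T)) := fun i =>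
  ⟨1, fun _ => 0, fun _ _ _ => rfl, fun v => by simp⟩

theorem IsTriangular.mul {g h : Equiv.Perm (PathModule p n T)} (hg : IsTriangular g)
    (hh : IsTriangular h) : IsTriangular (g * h) := by
  intro i
  obtain ⟨τ, f, hf, hgv⟩ := hg i
  obtain ⟨σ, e, he, hhv⟩ := hh i
  refine ⟨τ * σ, fun v => translate p τ (e v) + f (h v), fun v w hvw => ?_, fun v => ?_⟩
  · simp only
    rw [he v w hvw]
    congr 1
    refine hf _ _ fun k hk => ?_
    obtain ⟨σ', e', he', hhv'⟩ := hh k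
    rw [hhv', hhv', hvw k hk, he' v w fun m hm => hvw m (hk.trans hm)]
  · rw [Equiv.Perm.mul_apply, hgv, hhv, translate_mul, translate_add, add_assoc]

theorem IsTriangular.pow {g : Equiv.Perm (PathModule p n T)} (hg : IsTriangular g) (k : ℕ) :
    IsTriangular (g ^ k) := by
  induction k with
  | zero => exact isTriangular_one
  | succ k ih => rw [pow_succ]; exact ih.mul hg

theorem isTriangular_pathHom (c : Fin n → J)
    (hc : ∀ i j : Fin n, (j : ℕ) = i + 1 → c i ≠ c j) (x : CoprodI fun _ : J => T) :
    IsTriangular (pathHom p T c hc x) := by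
  induction x using CoprodI.induction_on with
  | one => rw [map_one]; exact isTriangular_one
  | mul x y hx hy => rw [map_mul]; exact hx.mul hy
  | of j t =>
    intro i
    induction i using Fin.lastCases with
    | last => exact ⟨1, fun _ => 0, fun _ _ _ => rfl, fun v => by simp⟩
    | cast i =>
      refine ⟨edgeElement c j t i,
        fun v => translate p (edgeElement c j t i) (v i.succ) - v i.succ, fun v w h => ?_,
        fun v => ?_⟩
      · simp only
        rw [h i.succ (by simp [Fin.lt_def])]
      · rw [pathHom_of, pathAct_castSucc, translate_add, add_sub_assoc]

theorem pow_apply_of_fixes {T : Type*} {h : Equiv.Perm (PathModule p n T)} {i : Fin (n + 1)}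
    (hfix : ∀ v k, i < k → h v k = v k) (j : ℕ) (v : PathModule p n T) (k : Fin (n + 1))
    (hk : i < k) : (h ^ j) v k = v k := by
  induction j with
  | zero => rfl
  | succ j ih => rw [pow_succ', Equiv.Perm.mul_apply, hfix _ k hk, ih]

theorem pow_apply_of_triangular {h : Equiv.Perm (PathModule p n T)} {i : Fin (n + 1)}
    (hfix : ∀ v k, i < k → h v k = v k) {τ : Fin n → T}
    {f : PathModule p n T → (Fin n → T) → ZMod p} (hf : DependsAbove i f)
    (hv : ∀ v, h v i = translate p τ (v i) + f v) (j : ℕ) :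
    ∃ e : PathModule p n T → (Fin n → T) → ZMod p, DependsAbove i e ∧
      ∀ v, (h ^ j) v i = translate p (τ ^ j) (v i) + e v := by
  induction j with
  | zero => exact ⟨fun _ => 0, fun _ _ _ => rfl, fun v => by simp⟩
  | succ j ih =>
    obtain ⟨e, he, hev⟩ := ih
    refine ⟨fun v => translate p τ (e v) + f v, fun v w hvw => ?_, fun v => ?_⟩
    · simp only
      rw [he v w hvw, hf v w hvw]
    · rw [pow_succ', Equiv.Perm.mul_apply, hv, hev, pow_succ', translate_mul, translate_add,
        add_assoc, hf ((h ^ j) v) v fun k hk => pow_apply_of_fixes hfix j v k hk]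

/-- The entries are trivialized from the last one upwards. Once a power fixes all later entries, it
acts on the current one by a translation plus a term depending only on the fixed entries: a power of
`p` kills the translation, and a further `p`-th power kills the additive term because the
coefficients are in `ZMod p`. -/
theorem IsTriangular.exists_pow_eq_one [Finite T] (hT : IsPGroup p T)
    {g : Equiv.Perm (PathModule p n T)} (hg : IsTriangular g) : ∃ N : ℕ, g ^ p ^ N = 1 := by
  have key : ∀ m : ℕ, m ≤ n + 1 → ∃ N : ℕ, ∀ v, ∀ i : Fin (n + 1), n + 1 - m ≤ (i : ℕ) →
      (g ^ p ^ N) v i = v i := by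
    intro m
    induction m with
    | zero => exact fun _ => ⟨0, fun v i hi => by omega⟩
    | succ m ih =>
      intro hm
      obtain ⟨N, hN⟩ := ih (by omega)
      set i : Fin (n + 1) := ⟨n - m, by omega⟩ with hi
      set h := g ^ p ^ N with hh
      have hfix : ∀ v k, i < k → h v k = v k := fun v k hk => hN v k (by
        rw [Fin.lt_def] at hk
        simp only [hi] at hk
        omega)
      obtain ⟨τ, f, hf, hv⟩ := hg.pow (p ^ N) i
      obtain ⟨M, hM⟩ : ∃ M : ℕ, τ ^ p ^ M = 1 := by
        choose M hM using fun k => hT (τ k)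
        refine ⟨∑ k, M k, funext fun k => ?_⟩
        obtain ⟨d, hd⟩ := Nat.exists_eq_add_of_le
          (Finset.single_le_sum (f := M) (fun _ _ => Nat.zero_le _) (Finset.mem_univ k))
        rw [Pi.pow_apply, hd, pow_add, pow_mul, hM, one_pow]
        rfl
      obtain ⟨e, he, hev⟩ := pow_apply_of_triangular hfix hf hv (p ^ M)
      have hfix' : ∀ v k, i < k → (h ^ p ^ M) v k = v k := fun v k hk =>
        pow_apply_of_fixes hfix _ v k hk
      have hev' : ∀ j v, ((h ^ p ^ M) ^ j) v i = v i + j • e v := by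
        intro j v
        induction j with
        | zero => simp
        | succ j ih =>
          rw [pow_succ', Equiv.Perm.mul_apply, hev, ih, hM, translate_one,
            he _ v fun k hk => pow_apply_of_fixes hfix' j v k hk, succ_nsmul, add_assoc]
      refine ⟨N + M + 1, fun v k hk => ?_⟩
      have e1 : g ^ p ^ (N + M + 1) = (h ^ p ^ M) ^ p := by
        rw [hh, ← pow_mul, ← pow_mul, pow_succ p, pow_add, mul_assoc]
      rw [e1]
      by_cases hki : i < k
      · exact pow_apply_of_fixes hfix' p v k hki
      · obtain rfl : k = i := by
          rw [Fin.lt_def] at hki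
          rw [Fin.ext_iff]
          simp only [hi] at hki ⊢
          omega
        rw [hev']
        funext x
        simp
  obtain ⟨N, hN⟩ := key (n + 1) le_rfl
  exact ⟨N, Equiv.ext fun v => funext fun i => hN v i (by omega)⟩

/-- Applied to a point mass at `1` in the last entry, the letters, taken from the right, each carry
the nonzero part one entry up, by the factor `t - 1`. At `1` the `t`-translate vanishes, because the
support so far has trivial coordinates on the edges not yet passed, so only the term `-1` survives.
-/
theorem pathHom_listProd_drop (l : List (Σ _ : J, T)) (hl : IsReduced l)
    (hc : ∀ i j : Fin l.length, (j : ℕ) = i + 1 → (l.get i).1 ≠ (l.get j).1)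
    (v : PathModule p l.length T) (hv : ∀ k, k ≠ Fin.last _ → v k = 0)
    (hv1 : v (Fin.last _) 1 ≠ 0) (hv2 : ∀ x, x ≠ 1 → v (Fin.last _) x = 0) (m : ℕ)
    (hm : m ≤ l.length) :
    (∀ k : Fin (l.length + 1), (k : ℕ) < l.length - m →
      pathHom p T (fun i => (l.get i).1) hc (listProd (l.drop (l.length - m))) v k = 0) ∧
    pathHom p T (fun i => (l.get i).1) hc (listProd (l.drop (l.length - m))) v
      ⟨l.length - m, by omega⟩ 1 ≠ 0 ∧
    ∀ x : Fin l.length → T, (∃ k : Fin l.length, (k : ℕ) < l.length - m ∧ x k ≠ 1) →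
      pathHom p T (fun i => (l.get i).1) hc (listProd (l.drop (l.length - m))) v
        ⟨l.length - m, by omega⟩ x = 0 := by
  induction m with
  | zero =>
    have e : pathHom p T (fun i => (l.get i).1) hc (listProd (l.drop (l.length - 0))) v = v := by
      rw [Nat.sub_zero, List.drop_length, listProd_nil, map_one, Equiv.Perm.one_apply]
    rw [e]
    refine ⟨fun k hk => hv k (fun e => ?_), hv1, ?_⟩
    · rw [e] at hk
      simp at hk
    · rintro x ⟨k, -, hk⟩
      exact hv2 x (fun e => hk (by rw [e]; rfl))
  | succ m ih =>
    obtain ⟨h1, h2, h3⟩ := ih (by omega)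
    set i : Fin l.length := ⟨l.length - (m + 1), by omega⟩ with hi
    have hi1 : l.length - m = i + 1 := by simp only [hi]; omega
    have hi0 : l.length - (m + 1) = i := rfl
    have hcs : (⟨l.length - (m + 1), by omega⟩ : Fin (l.length + 1)) = i.castSucc := rfl
    have hsc : (⟨l.length - m, by omega⟩ : Fin (l.length + 1)) = i.succ := by
      rw [Fin.ext_iff]
      exact hi1
    rw [hsc] at h2 h3
    rw [hi1] at h1 h2 h3
    rw [hcs]
    simp only [hi0]
    rw [List.drop_eq_getElem_cons i.2, listProd_cons, map_mul]
    simp only [Equiv.Perm.mul_apply, pathHom_of]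
    set u := pathHom p T (fun i => (l.get i).1) hc (listProd (l.drop (i + 1))) v with hu
    have hval : ∀ x, pathAct p (fun i => (l.get i).1) l[(i : ℕ)].1 l[(i : ℕ)].2 u i.castSucc x =
        u i.succ ((Pi.mulSingle i l[(i : ℕ)].2)⁻¹ * x) - u i.succ x := by
      intro x
      rw [pathAct_castSucc, h1 i.castSucc (by simp), zero_add]
      simp [edgeElement, translate]
    refine ⟨fun k hk => ?_, ?_, ?_⟩
    · obtain ⟨k', rfl⟩ : ∃ k' : Fin l.length, k'.castSucc = k :=
        ⟨⟨k, by omega⟩, rfl⟩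
      rw [pathAct_castSucc, h1 k'.castSucc (by simp at hk ⊢; omega),
        h1 k'.succ (by simpa using hk), add_zero, sub_zero]
      rfl
    · rw [hval, h3 _ ⟨i, by omega, ?_⟩, zero_sub]
      · exact neg_ne_zero.2 h2
      · simpa using hl.1 _ (List.getElem_mem i.2)
    · rintro x ⟨k, hk, hxk⟩
      rw [hval, h3 x ⟨k, by omega, hxk⟩, h3 _ ⟨k, by omega, ?_⟩, sub_zero]
      have : k ≠ i := fun e => by rw [e] at hk; omega
      simpa [this] using hxk

/-- Free products of copies of a finite `p`-group are residually `p`-finite. -/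
theorem isResiduallyP_coprodI (hp : p.Prime) [Finite T] (hT : IsPGroup p T) :
    IsResiduallyP p (CoprodI fun _ : J => T) := by
  intro x hx
  obtain ⟨l, hl, rfl⟩ := exists_isReduced x
  have hc : ∀ i j : Fin l.length, (j : ℕ) = i + 1 → (l.get i).1 ≠ (l.get j).1 := by
    rintro ⟨i, hi⟩ ⟨j, hj⟩ hij
    simp only at hij
    subst hij
    exact (List.isChain_iff_getElem.1 hl.2) i hj
  have : NeZero p := ⟨hp.ne_zero⟩
  set φ := pathHom p T (fun i => (l.get i).1) hc with hφ
  have hker : IsCoPFinite p φ.rangeRestrict.ker := by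
    refine isCoPFinite_ker ?_ _
    rintro ⟨_, y, rfl⟩
    obtain ⟨N, hN⟩ := (isTriangular_pathHom (fun i => (l.get i).1) hc y).exists_pow_eq_one hT
    exact ⟨N, Subtype.ext hN⟩
  refine ⟨_, hker, fun h => ?_⟩
  rw [MonoidHom.ker_rangeRestrict, MonoidHom.mem_ker] at h
  classical
  have := Fact.mk hp
  have h2 := (pathHom_listProd_drop (p := p) l hl hc
    (fun k x => if k = Fin.last _ ∧ x = 1 then 1 else 0)
    (fun k hk => funext fun x => if_neg fun e => hk e.1) (by simp) (fun x hx => by simp [hx])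
    l.length le_rfl).2.1
  simp only [Nat.sub_self, List.drop_zero] at h2
  -- The first entry of the test vector itself is zero, as the list is nonempty, so the identity
  -- cannot produce a nonzero one.
  rw [← hφ, h, Equiv.Perm.one_apply, if_neg] at h2
  · exact h2 rfl
  · rintro ⟨e, -⟩
    have : l.length = 0 := by simpa using (congrArg Fin.val e).symm
    exact hx (by rw [List.length_eq_zero_iff.1 this, listProd_nil])

end ResidualFreeProduct

/-! ### Free powers and maps between them. -/

section FreePower

variable {X Y B C : Type*} [Group B] [Group C]

/-- The free product of copies of `B` indexed by `X`. -/
abbrev FreePower (X B : Type*) [Group B] : Type _ := CoprodI fun _ : X => B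

/-- The inclusion of the copy of `B` with index `x`. -/
def factor (x : X) : B →* FreePower X B := CoprodI.of (M := fun _ : X => B) (i := x)

/-- The homomorphism given by homomorphisms on the factors. -/
def freeLift (f : X → B →* C) : FreePower X B →* C := CoprodI.lift f

@[simp] theorem freeLift_factor (f : X → B →* C) (x : X) (b : B) :
    freeLift f (factor x b) = f x b := CoprodI.lift_of f b

theorem freePower_hom_ext {f g : FreePower X B →* C}
    (h : ∀ x b, f (factor x b) = g (factor x b)) : f = g :=
  CoprodI.ext_hom f g fun x => MonoidHom.ext fun b => h x b

theorem factor_injective (x : X) : Function.Injective (factor x : B →* FreePower X B) :=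
  CoprodI.of_injective x

/-- The homomorphism induced by a map of index sets. -/
def reindex (B : Type*) [Group B] (σ : X → Y) : FreePower X B →* FreePower Y B :=
  freeLift fun x => factor (σ x)

@[simp] theorem reindex_factor (σ : X → Y) (x : X) (b : B) :
    reindex B σ (factor x b) = factor (σ x) b := by simp [reindex]

end FreePower

open SemidirectProduct (inl inr rightHom)

/-! ### Free wreath products and their residual `p`-finiteness. -/

section FreeWreath

variable {A X B : Type*} [Group A] [MulAction A X] [Group B]

/-- The action of a group on a free power by permutations of the factors. -/
def permuteFactors (A X B : Type*) [Group A] [MulAction A X] [Group B] :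
    A →* MulAut (FreePower X B) where
  toFun a := MonoidHom.toMulEquiv (reindex B fun x : X => a • x) (reindex B fun x : X => a⁻¹ • x)
    (freePower_hom_ext fun x b => by simp) (freePower_hom_ext fun x b => by simp)
  map_one' := MulEquiv.toMonoidHom_injective (freePower_hom_ext fun x b => by simp)
  map_mul' a b := MulEquiv.toMonoidHom_injective (freePower_hom_ext fun x b => by simp [mul_smul])

@[simp] theorem permuteFactors_factor (a : A) (x : X) (b : B) :
    permuteFactors A X B a (factor x b) = factor (a • x) b := by simp [permuteFactors]

/-- The free wreath product: the semidirect product of the free power of `B` indexed by the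
`A`-set `X`, by the group `A`. -/
abbrev FreeWreath (A X B : Type*) [Group A] [MulAction A X] [Group B] : Type _ :=
  FreePower X B ⋊[permuteFactors A X B] A

theorem wreath_hom_ext {C : Type*} [Group C] {f g : FreeWreath A X B →* C}
    (h1 : ∀ x b, f (inl (factor x b)) = g (inl (factor x b))) (h2 : ∀ a, f (inr a) = g (inr a)) :
    f = g :=
  SemidirectProduct.hom_ext (freePower_hom_ext h1) (MonoidHom.ext h2)

theorem inr_mul_inl_factor (a : A) (x : X) (b : B) :
    (inr a * inl (factor x b) * (inr a)⁻¹ : FreeWreath A X B) = inl (factor (a • x) b) := by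
  rw [← map_inv, ← SemidirectProduct.inl_aut, permuteFactors_factor]

/-- The homomorphism on a free wreath product given by compatible homomorphisms. -/
def wreathLift {C : Type*} [Group C] (f : X → B →* C) (g : A →* C)
    (h : ∀ a x b, f (a • x) b = g a * f x b * (g a)⁻¹) : FreeWreath A X B →* C :=
  SemidirectProduct.lift (freeLift f) g fun a => freePower_hom_ext fun x b => by simp [h]

@[simp] theorem wreathLift_inl_factor {C : Type*} [Group C] (f : X → B →* C) (g : A →* C)
    (h : ∀ a x b, f (a • x) b = g a * f x b * (g a)⁻¹) (x : X) (b : B) :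
    wreathLift f g h (inl (factor x b)) = f x b := by simp [wreathLift]

@[simp] theorem wreathLift_inr {C : Type*} [Group C] (f : X → B →* C) (g : A →* C)
    (h : ∀ a x b, f (a • x) b = g a * f x b * (g a)⁻¹) (a : A) :
    wreathLift f g h (inr a) = g a := by simp [wreathLift]

theorem commute_inl_reindex_inr {S : Type*} (σ : S → X) (a : A) (h : ∀ x, a • σ x = σ x)
    (f : FreePower S B) : Commute (inl (reindex B σ f) : FreeWreath A X B) (inr a) := by
  have : (permuteFactors A X B a).toMonoidHom.comp (reindex B σ) = reindex B σ :=
    freePower_hom_ext fun x b => by simp [h]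
  have h1 : permuteFactors A X B a (reindex B σ f) = reindex B σ f := DFunLike.congr_fun this f
  have h2 := SemidirectProduct.inl_aut (φ := permuteFactors A X B) a (reindex B σ f)
  rw [h1, map_inv] at h2
  exact (eq_mul_inv_iff_mul_eq.1 h2)

theorem exists_isCoPFinite_forall_mem {p : ℕ} {G α : Type*} [Group G] (P : α → Subgroup G → Prop)
    (hP : ∀ a M N, M ≤ N → P a N → P a M) (l : List α)
    (h : ∀ a ∈ l, ∃ N, IsCoPFinite p N ∧ P a N) :
    ∃ N, IsCoPFinite p N ∧ ∀ a ∈ l, P a N := by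
  induction l with
  | nil => exact ⟨⊤, isCoPFinite_top p G, by simp⟩
  | cons a l ih =>
    obtain ⟨N, hN, hl⟩ := ih fun b hb => h b (List.mem_cons_of_mem _ hb)
    obtain ⟨M, hM, ha⟩ := h a List.mem_cons_self
    refine ⟨M ⊓ N, hM.inf hN, fun b hb => ?_⟩
    rcases List.mem_cons.1 hb with rfl | hb
    · exact hP _ _ _ inf_le_left ha
    · exact hP _ _ _ inf_le_right (hl b hb)

/-- Free wreath products of residually `p`-finite groups are residually `p`-finite if the points of
the permuted set are separated by the orbits of co-`p`-finite subgroups. -/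
theorem isResiduallyP_freeWreath {p : ℕ} (hp : p.Prime) (hA : IsResiduallyP p A)
    (hB : IsResiduallyP p B)
    (hX : ∀ x y : X, x ≠ y → ∃ N : Subgroup A, IsCoPFinite p N ∧ ∀ n ∈ N, n • y ≠ x) :
    IsResiduallyP p (FreeWreath A X B) := by
  intro e he
  by_cases hr : rightHom e = 1
  swap
  · obtain ⟨N, hN, h⟩ := hA _ hr
    exact ⟨N.comap rightHom, hN.comap _, h⟩
  obtain ⟨f, rfl⟩ : e ∈ (inl : FreePower X B →* FreeWreath A X B).range := by
    rw [SemidirectProduct.range_inl_eq_ker_rightHom]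
    exact hr
  obtain ⟨l, hl, rfl⟩ := exists_isReduced f
  -- `M` keeps the letters of `l` nontrivial; `N` keeps distinct indices occurring in `l` in
  -- distinct `N`-orbits.
  obtain ⟨M, hM, hMl⟩ := exists_isCoPFinite_forall_mem
    (fun (s : Σ _ : X, B) (N : Subgroup B) => s.2 ∉ N) (fun a M N hMN h h' => h (hMN h')) l
    fun s hs => hB s.2 (hl.1 s hs)
  obtain ⟨N, hN, hNl⟩ := exists_isCoPFinite_forall_mem
    (fun (s : (Σ _ : X, B) × (Σ _ : X, B)) (N : Subgroup A) =>
      s.1.1 ≠ s.2.1 → ∀ n ∈ N, n • s.2.1 ≠ s.1.1)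
    (fun a M N hMN h hne n hn => h hne n (hMN hn)) (l ×ˢ l) fun s _ => by
      by_cases hs : s.1.1 = s.2.1
      · exact ⟨⊤, isCoPFinite_top p A, fun h => absurd hs h⟩
      · obtain ⟨N, hN, h⟩ := hX _ _ hs
        exact ⟨N, hN, fun _ => h⟩
  obtain ⟨hMn, hMf, hMp⟩ := hM
  let J := MulAction.orbitRel.Quotient N X
  -- Under `κ` the list `l` stays reduced, hence nontrivial, in a free product of copies of a finite
  -- `p`-group.
  let κ : FreePower X B →* FreePower J (B ⧸ M) :=
    freeLift fun x => (factor (Quotient.mk _ x : J)).comp (QuotientGroup.mk' M)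
  have hκ : ∀ n ∈ N, ∀ y, κ (permuteFactors A X B n y) = κ y := by
    intro n hn y
    have : κ.comp (permuteFactors A X B n).toMonoidHom = κ := freePower_hom_ext fun x b => by
      have : (Quotient.mk _ (n • x) : J) = Quotient.mk _ x :=
        Quotient.sound ⟨⟨n, hn⟩, rfl⟩
      simp [κ, this]
    exact DFunLike.congr_fun this y
  have hκl : κ (listProd l) ≠ 1 := by
    have e1 : κ (listProd l) =
        listProd (G := fun _ : J => B ⧸ M) (l.map fun s => ⟨Quotient.mk _ s.1, (s.2 : B ⧸ M)⟩) := by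
      clear hl hr he hMl hNl
      induction l with
      | nil => simp
      | cons s l ih =>
        rw [listProd_cons, map_mul, ih, List.map_cons, listProd_cons]
        congr 1
    have e2 : IsReduced (G := fun _ : J => B ⧸ M)
        (l.map fun s => ⟨Quotient.mk _ s.1, (s.2 : B ⧸ M)⟩) := by
      refine ⟨fun s hs => ?_, ?_⟩
      · obtain ⟨t, ht, rfl⟩ := List.mem_map.1 hs
        exact fun h => hMl t ht ((QuotientGroup.eq_one_iff _).1 h)
      · rw [List.isChain_map]
        refine hl.2.imp_of_mem_imp fun a b ha hb hab h => ?_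
        obtain ⟨n, hn⟩ := Quotient.exact h
        exact hNl (a, b) (List.mem_product.2 ⟨ha, hb⟩) hab n n.2 hn
    rw [e1]
    intro h
    have h3 := e2.eq_of_listProd_eq isReduced_nil h
    rw [List.map_eq_nil_iff] at h3
    exact he (by rw [h3, listProd_nil, map_one])
  obtain ⟨K, hK, hKl⟩ := isResiduallyP_coprodI hp hMp _ hκl
  let E₀ : Subgroup (FreeWreath A X B) := N.comap rightHom
  -- Since `κ` is invariant under `N`, it extends to the preimage of `N` by ignoring the `A`-part.
  let θ : E₀ →* FreePower J (B ⧸ M) :=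
    { toFun := fun e => κ e.1.left
      map_one' := by simp
      map_mul' := fun a b => by
        simp only [Subgroup.coe_mul, SemidirectProduct.mul_left, map_mul]
        exact congrArg _ (hκ a.1.right a.2 _) }
  have hcore := (hN.comap (rightHom : FreeWreath A X B →* A)).normalCore hp
    (N := (K.comap θ).map E₀.subtype) (Subgroup.map_subtype_le _) (by
      rw [subgroupOf, comap_map_eq_self_of_injective E₀.subtype_injective]
      exact hK.comap θ)
  refine ⟨_, hcore, fun h => ?_⟩
  obtain ⟨y, hy, hyl⟩ := Subgroup.normalCore_le _ h
  refine hKl ?_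
  have : κ y.1.left ∈ K := hy
  rwa [show y.1 = _ from hyl] at this

end FreeWreath

/-! ### Free wreath products with `ℤ` as free products. -/

section IntegerWreath

variable {X B : Type*} [Group B] [MulAction (Multiplicative ℤ) X]

local notation "Z" => Multiplicative ℤ

/-- The orbits without fixed points. -/
abbrev MovedOrbits (X : Type*) [MulAction (Multiplicative ℤ) X] : Type _ :=
  {o : MulAction.orbitRel.Quotient Z X // o.out ∉ MulAction.fixedPoints Z X}

/-- The factors of the free decomposition of a free wreath product with an infinite cyclic
group. -/
def WreathFactor (X B : Type*) [Group B] [MulAction (Multiplicative ℤ) X] : Bool → Type _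
  | true => FreePower (MulAction.fixedPoints Z X) B × Z
  | false => FreePower (MovedOrbits X) B

instance : ∀ b, Group (WreathFactor X B b)
  | true => inferInstanceAs (Group (FreePower (MulAction.fixedPoints Z X) B × Z))
  | false => inferInstanceAs (Group (FreePower (MovedOrbits X) B))

/-- The free product which is isomorphic to the free wreath product. -/
abbrev WreathCoprod (X B : Type*) [Group B] [MulAction (Multiplicative ℤ) X] : Type _ :=
  CoprodI (WreathFactor X B)

/-- The inclusion of the factor made from the fixed points. -/
def fixedPart (X B : Type*) [Group B] [MulAction (Multiplicative ℤ) X] :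
    FreePower (MulAction.fixedPoints Z X) B × Z →* WreathCoprod X B :=
  CoprodI.of (M := WreathFactor X B) (i := true)

/-- The inclusion of the factor made from the moved points. -/
def movedPart (X B : Type*) [Group B] [MulAction (Multiplicative ℤ) X] :
    FreePower (MovedOrbits X) B →* WreathCoprod X B :=
  CoprodI.of (M := WreathFactor X B) (i := false)

/-- The homomorphism of the fixed part into the free wreath product. -/
def fixedPartHom (X B : Type*) [Group B] [MulAction (Multiplicative ℤ) X] :
    FreePower (MulAction.fixedPoints Z X) B × Z →* FreeWreath Z X B :=
  MonoidHom.noncommCoprod (inl.comp (reindex B Subtype.val)) inr fun f z =>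
    commute_inl_reindex_inr _ z (fun x => x.2 z) f

/-- The homomorphism of the moved part into the free wreath product. -/
noncomputable def movedPartHom (X B : Type*) [Group B] [MulAction (Multiplicative ℤ) X] :
    FreePower (MovedOrbits X) B →* FreeWreath Z X B :=
  inl.comp (reindex B fun o => o.1.out)

/-- The comparison homomorphism from the free product to the free wreath product. -/
noncomputable def coprodToWreath (X B : Type*) [Group B] [MulAction (Multiplicative ℤ) X] :
    WreathCoprod X B →* FreeWreath Z X B :=
  CoprodI.lift fun
    | true => fixedPartHom X B
    | false => movedPartHom X B

@[simp] theorem coprodToWreath_fixedPart (x : FreePower (MulAction.fixedPoints Z X) B × Z) :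
    coprodToWreath X B (fixedPart X B x) = inl (reindex B Subtype.val x.1) * inr x.2 :=
  CoprodI.lift_of _ _

@[simp] theorem coprodToWreath_movedPart (x : FreePower (MovedOrbits X) B) :
    coprodToWreath X B (movedPart X B x) = inl (reindex B (fun o => o.1.out) x) :=
  CoprodI.lift_of _ _

theorem exists_smul_out (x : X) :
    ∃ z : Z, z • (Quotient.mk _ x : MulAction.orbitRel.Quotient Z X).out = x :=
  Quotient.exact (s := MulAction.orbitRel Z X) (Quotient.out_eq _).symm

theorem smul_mem_fixedPoints_iff {z : Z} {x : X} :
    z • x ∈ MulAction.fixedPoints Z X ↔ x ∈ MulAction.fixedPoints Z X := by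
  refine ⟨fun h w => ?_, fun h => by rwa [h z]⟩
  have := h w
  rw [smul_comm] at this
  exact MulAction.injective z this

theorem exists_eq_smul_out {x : X} (hx : x ∉ MulAction.fixedPoints Z X) :
    ∃ (z : Z) (o : MovedOrbits X), x = z • o.1.out := by
  obtain ⟨z, hz⟩ := exists_smul_out x
  refine ⟨z, ⟨Quotient.mk _ x, fun h => hx ?_⟩, hz.symm⟩
  rw [← hz, smul_mem_fixedPoints_iff]
  exact h

open Classical in
/-- The image of a factor of the free power in the free product. -/
noncomputable def wreathFactorHom (B : Type*) [Group B] (x : X) : B →* WreathCoprod X B :=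
  if h : x ∈ MulAction.fixedPoints Z X then
    (fixedPart X B).comp ((MonoidHom.inl _ _).comp (factor ⟨x, h⟩))
  else
    (MulAut.conj (fixedPart X B (1, (exists_eq_smul_out h).choose))).toMonoidHom.comp
      ((movedPart X B).comp (factor (exists_eq_smul_out h).choose_spec.choose))

theorem wreathFactorHom_of_mem {x : X} (h : x ∈ MulAction.fixedPoints Z X) (b : B) :
    wreathFactorHom B x b = fixedPart X B (factor ⟨x, h⟩ b, 1) := by
  rw [wreathFactorHom, dif_pos h]
  rfl

-- Each orbit is a fixed point or regular. In a regular orbit the factors are the conjugates of one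
-- of them by the distinct elements of `ℤ`, so they contribute a single free factor `B`; factors at
-- fixed points commute with `ℤ`.
variable (hfree : ∀ (x : X) (z : Z), z ≠ 1 → z • x = x → x ∈ MulAction.fixedPoints Z X)

-- Regularity of the orbit makes the chosen pair in `wreathFactorHom` unique, so the choice can be
-- computed.
include hfree in
theorem wreathFactorHom_smul_out (z : Z) (o : MovedOrbits X) (b : B) :
    wreathFactorHom B (z • o.1.out) b =
      fixedPart X B (1, z) * movedPart X B (factor o b) * (fixedPart X B (1, z))⁻¹ := by
  have h : z • o.1.out ∉ MulAction.fixedPoints Z X := by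
    rw [smul_mem_fixedPoints_iff]
    exact o.2
  obtain ⟨w, hw⟩ : ∃ w, w = (exists_eq_smul_out h).choose := ⟨_, rfl⟩
  obtain ⟨q, hq⟩ : ∃ q, q = (exists_eq_smul_out h).choose_spec.choose := ⟨_, rfl⟩
  have hs : z • o.1.out = w • q.1.out := by
    rw [hw, hq]
    exact (exists_eq_smul_out h).choose_spec.choose_spec
  have hoq : o = q := by
    refine Subtype.ext ?_
    rw [← Quotient.out_eq o.1, ← Quotient.out_eq q.1]
    refine Quotient.sound ⟨z⁻¹ * w, ?_⟩
    simp only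
    rw [mul_smul, ← hs, inv_smul_smul]
  subst hoq
  have hzw : z = w := by
    by_contra hne
    refine o.2 (hfree _ (w⁻¹ * z) (fun e => hne ?_) ?_)
    · exact (inv_mul_eq_one.1 e).symm
    · rw [mul_smul, hs, inv_smul_smul]
  rw [wreathFactorHom, dif_neg h, ← hq, ← hw, hzw]
  rfl

include hfree in
theorem wreathFactorHom_smul (z : Z) (x : X) (b : B) : wreathFactorHom B (z • x) b =
    fixedPart X B (1, z) * wreathFactorHom B x b * (fixedPart X B (1, z))⁻¹ := by
  by_cases h : x ∈ MulAction.fixedPoints Z X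
  · rw [h z, wreathFactorHom_of_mem h, ← map_inv, ← map_mul, ← map_mul]
    simp
  · obtain ⟨w, o, rfl⟩ := exists_eq_smul_out h
    rw [← mul_smul, wreathFactorHom_smul_out hfree, wreathFactorHom_smul_out hfree]
    have : ((1 : FreePower (MulAction.fixedPoints Z X) B), z * w) = (1, z) * (1, w) := by simp
    rw [this, map_mul]
    group

/-- The comparison homomorphism from the free wreath product to the free product. -/
noncomputable def wreathToCoprod : FreeWreath Z X B →* WreathCoprod X B :=
  wreathLift (wreathFactorHom B) ((fixedPart X B).comp (MonoidHom.inr _ _)) fun z x b =>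
    wreathFactorHom_smul hfree z x b

theorem wreathToCoprod_inl (x : X) (b : B) :
    wreathToCoprod hfree (inl (factor x b)) = wreathFactorHom B x b :=
  wreathLift_inl_factor _ _ _ _ _

theorem wreathToCoprod_inr (z : Z) :
    wreathToCoprod (B := B) hfree (inr z) = fixedPart X B (1, z) :=
  wreathLift_inr _ _ _ _

theorem wreathToCoprod_comp :
    (wreathToCoprod hfree).comp (coprodToWreath X B) = MonoidHom.id _ := by
  refine CoprodI.ext_hom _ _ fun b => ?_
  rcases b with - | -
  · refine freePower_hom_ext fun o b => ?_
    have h1 := wreathFactorHom_smul_out hfree 1 o b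
    rw [one_smul, ← Prod.one_eq_mk, map_one, one_mul, inv_one, mul_one] at h1
    change wreathToCoprod hfree (coprodToWreath X B (movedPart X B (factor o b))) =
      movedPart X B (factor o b)
    rw [coprodToWreath_movedPart, reindex_factor, wreathToCoprod_inl, h1]
  · suffices H : ∀ x, wreathToCoprod hfree (coprodToWreath X B (fixedPart X B x)) =
        fixedPart X B x from MonoidHom.ext H
    intro x
    have h1 : ∀ f, wreathToCoprod hfree (inl (reindex B Subtype.val f)) =
        fixedPart X B (f, 1) := by
      have : ((wreathToCoprod hfree).comp inl).comp (reindex B Subtype.val) =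
          (fixedPart X B).comp (MonoidHom.inl _ _) := freePower_hom_ext fun x b => by
        simp only [MonoidHom.comp_apply, reindex_factor, wreathToCoprod_inl]
        exact wreathFactorHom_of_mem x.2 b
      exact DFunLike.congr_fun this
    rw [coprodToWreath_fixedPart, map_mul, h1, wreathToCoprod_inr, ← map_mul]
    simp

theorem coprodToWreath_comp :
    (coprodToWreath X B).comp (wreathToCoprod hfree) = MonoidHom.id _ := by
  refine wreath_hom_ext (fun x b => ?_) fun z => ?_
  · rw [MonoidHom.comp_apply, wreathToCoprod_inl, MonoidHom.id_apply]
    by_cases h : x ∈ MulAction.fixedPoints Z X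
    · rw [wreathFactorHom_of_mem h, coprodToWreath_fixedPart]
      simp
    · obtain ⟨z, o, rfl⟩ := exists_eq_smul_out h
      rw [wreathFactorHom_smul_out hfree, map_mul, map_mul, map_inv,
        coprodToWreath_fixedPart, coprodToWreath_movedPart]
      simp only [map_one, one_mul, reindex_factor]
      exact inr_mul_inl_factor z _ b
  · rw [MonoidHom.comp_apply, wreathToCoprod_inr, coprodToWreath_fixedPart]
    simp

/-- A free wreath product with an infinite cyclic group which moves no point with a finite orbit
is a free product. -/
noncomputable def wreathEquiv : WreathCoprod X B ≃* FreeWreath Z X B :=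
  MonoidHom.toMulEquiv (coprodToWreath X B) (wreathToCoprod hfree) (wreathToCoprod_comp hfree)
    (coprodToWreath_comp hfree)

theorem wreathEquiv_apply (x : WreathCoprod X B) :
    wreathEquiv hfree x = coprodToWreath X B x := rfl

include hfree in
theorem isRooted_freeWreath_int (hB : IsRooted B) : IsRooted (FreeWreath Z X B) := by
  refine (isRooted_coprodI fun b => ?_).of_mulEquiv (wreathEquiv hfree)
  rcases b with - | -
  · exact isRooted_coprodI fun _ => hB
  · exact (isRooted_coprodI fun _ => hB).prod isRooted_multiplicative_int

include hfree in
/-- Commuting elements of a free wreath product with an infinite cyclic group, one of which is not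
in the base. -/
theorem commute_cases_freeWreath_int {r g : FreeWreath Z X B} (h : Commute r g)
    (hr : rightHom r ≠ 1) :
    (∃ t, r ∈ zpowers t ∧ g ∈ zpowers t) ∨
    ∃ (c : FreeWreath Z X B) (f f' : FreePower (MulAction.fixedPoints Z X) B) (z z' : Z),
      Commute f f' ∧ r = c * (inl (reindex B Subtype.val f) * inr z) * c⁻¹ ∧
      g = c * (inl (reindex B Subtype.val f') * inr z') * c⁻¹ := by
  obtain ⟨r, rfl⟩ := (wreathEquiv hfree).surjective r
  obtain ⟨g, rfl⟩ := (wreathEquiv hfree).surjective g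
  have h' : Commute r g := (wreathEquiv hfree).injective (by simpa using h.eq)
  rcases commute_cases h' with ⟨t, ⟨k, rfl⟩, ⟨l, rfl⟩⟩ | ⟨i, c, u, v, rfl, rfl⟩
  · exact Or.inl ⟨wreathEquiv hfree t, ⟨k, by simp⟩, ⟨l, by simp⟩⟩
  rcases i with - | -
  -- The moved part lies in the base, so its conjugates have trivial image in `ℤ`.
  · refine absurd ?_ hr
    have : wreathEquiv hfree (CoprodI.of u) = inl (reindex B (fun o => o.1.out) u) :=
      coprodToWreath_movedPart u
    rw [map_mul (wreathEquiv hfree), map_mul (wreathEquiv hfree), map_inv (wreathEquiv hfree),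
      this]
    simp
  · right
    have huv : Commute u v := by
      refine CoprodI.of_injective (M := WreathFactor X B) true ?_
      rw [map_mul, map_mul]
      have := h'.eq
      calc _ = c⁻¹ * ((c * CoprodI.of u * c⁻¹) * (c * CoprodI.of v * c⁻¹)) * c := by group
        _ = _ := by rw [this]; group
    refine ⟨wreathEquiv hfree c, u.1, v.1, u.2, v.2, congrArg Prod.fst huv.eq, ?_, ?_⟩
    · rw [map_mul, map_mul, map_inv, wreathEquiv_apply hfree (CoprodI.of u)]
      exact congrArg (fun y => _ * y * _) (coprodToWreath_fixedPart u)
    · rw [map_mul, map_mul, map_inv, wreathEquiv_apply hfree (CoprodI.of v)]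
      exact congrArg (fun y => _ * y * _) (coprodToWreath_fixedPart v)

end IntegerWreath

/-! ### Free wreath products inherit roots and separation. -/

section WreathClosure

variable {A X B : Type*} [Group A] [MulAction A X] [Group B]

/-- The embedding of a free wreath product with an infinite cyclic group given by an element of
infinite order. -/
def cyclicToWreath (B : Type*) [Group B] (s : A) [MulAction (Multiplicative ℤ) X]
    (hs : ∀ (z : Multiplicative ℤ) (x : X), z • x = zpowersHom A s z • x) :
    FreeWreath (Multiplicative ℤ) X B →* FreeWreath A X B :=
  SemidirectProduct.map (MonoidHom.id _) (zpowersHom A s) fun z =>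
    freePower_hom_ext fun x b => by
      change reindex B (fun x : X => z • x) (factor x b) =
        permuteFactors A X B (zpowersHom A s z) (factor x b)
      rw [reindex_factor, permuteFactors_factor, hs]

section Cyclic

variable {s : A} [MulAction (Multiplicative ℤ) X]
  (hs : ∀ (z : Multiplicative ℤ) (x : X), z • x = zpowersHom A s z • x)

theorem cyclicToWreath_inl (f : FreePower X B) : cyclicToWreath B s hs (inl f) = inl f := by
  simp [cyclicToWreath]

theorem cyclicToWreath_inr (z : Multiplicative ℤ) :
    cyclicToWreath B s hs (inr z) = inr (s ^ z.toAdd) := by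
  simp [cyclicToWreath]

theorem rightHom_cyclicToWreath (x : FreeWreath (Multiplicative ℤ) X B) :
    rightHom (cyclicToWreath B s hs x) = s ^ (rightHom x).toAdd := rfl

theorem cyclicToWreath_injective (h : ∀ m : ℤ, s ^ m = 1 → m = 0) :
    Function.Injective (cyclicToWreath B s hs) := by
  rw [injective_iff_map_eq_one]
  intro x hx
  have h1 : rightHom x = 1 := by
    have := congrArg rightHom hx
    rw [rightHom_cyclicToWreath, map_one] at this
    exact Multiplicative.toAdd.injective (h _ this)
  have h2 : x = inl x.left := by
    conv_lhs => rw [← SemidirectProduct.inl_left_mul_inr_right x]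
    rw [show x.right = 1 from h1, map_one, mul_one]
  rw [h2, cyclicToWreath_inl, ← map_one inl] at hx
  rw [h2, SemidirectProduct.inl_injective hx, map_one]

theorem exists_cyclicToWreath_eq {x : FreeWreath A X B} (hx : rightHom x ∈ zpowers s) :
    ∃ y, cyclicToWreath B s hs y = x := by
  obtain ⟨m, hm⟩ := mem_zpowers_iff.1 hx
  refine ⟨inl x.left * inr (Multiplicative.ofAdd m), ?_⟩
  rw [map_mul, cyclicToWreath_inl, cyclicToWreath_inr, toAdd_ofAdd, hm]
  exact SemidirectProduct.inl_left_mul_inr_right x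

end Cyclic

/-- This turns closure of stabilizers under roots into the dichotomy between fixed and regular
orbits for `⟨s⟩`. -/
theorem zpow_smul_eq_of_zpow_smul_eq {s : A}
    (hX : ∀ (x : X) (a : A) (n : ℕ), 0 < n → a ^ n • x = x → a • x = x) {x : X} {m : ℤ}
    (hm : m ≠ 0) (h : s ^ m • x = x) (k : ℤ) : s ^ k • x = x := by
  have h1 : s • x = x := by
    refine hX x s m.natAbs (by omega) ?_
    rcases Int.natAbs_eq m with e | e
    · rw [e] at h
      exact_mod_cast h
    · rw [e, zpow_neg, inv_smul_eq_iff] at h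
      exact_mod_cast h.symm
  exact zpow_mem (K := MulAction.stabilizer A x) h1 k

/-- Roots of base elements stay in the base because `A` is torsion-free. Roots of any other element
stay in the preimage of `⟨s⟩`, with `s` the isolated root of its image in `A`, and this preimage is
a free wreath product over `ℤ`. -/
theorem isRooted_freeWreath (hA : IsRooted A) (hB : IsRooted B)
    (hX : ∀ (x : X) (a : A) (n : ℕ), 0 < n → a ^ n • x = x → a • x = x) :
    IsRooted (FreeWreath A X B) := by
  intro x hx
  by_cases hr : rightHom x = 1
  · obtain ⟨f, rfl⟩ : x ∈ (inl : FreePower X B →* FreeWreath A X B).range := by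
      rw [SemidirectProduct.range_inl_eq_ker_rightHom]
      exact hr
    obtain ⟨t, ht, k, rfl⟩ := isRooted_coprodI (fun _ : X => hB) f (by
      rintro rfl
      exact hx (map_one _))
    refine ⟨inl t, ⟨fun m hm => ht.eq_zero_of_zpow m ?_, fun y n hn hy => ?_⟩, k, by simp⟩
    · exact SemidirectProduct.inl_injective (by rw [map_zpow, hm, map_one])
    · obtain ⟨m, hm⟩ := mem_zpowers_iff.1 hy
      obtain ⟨g, rfl⟩ : y ∈ (inl : FreePower X B →* FreeWreath A X B).range := by
        rw [SemidirectProduct.range_inl_eq_ker_rightHom]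
        refine hA.eq_one_of_pow hn ?_
        change rightHom y ^ n = 1
        rw [← map_pow, ← hm, map_zpow, SemidirectProduct.rightHom_inl, one_zpow]
      obtain ⟨j, rfl⟩ := mem_zpowers_iff.1 (ht.mem_of_pow g n hn ⟨m,
        SemidirectProduct.inl_injective (by simpa using hm)⟩)
      exact ⟨j, by simp⟩
  · obtain ⟨s, hs, hxs⟩ := hA _ hr
    let _ : MulAction (Multiplicative ℤ) X := MulAction.compHom X (zpowersHom A s)
    have hact : ∀ (z : Multiplicative ℤ) (x : X), z • x = zpowersHom A s z • x := fun _ _ => rfl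
    have hfree : ∀ (x : X) (z : Multiplicative ℤ), z ≠ 1 → z • x = x →
        x ∈ MulAction.fixedPoints (Multiplicative ℤ) X := fun x z hz h w =>
      zpow_smul_eq_of_zpow_smul_eq hX (m := z.toAdd) (fun e => hz (Multiplicative.toAdd.injective e)) h _
    have hinj := cyclicToWreath_injective (B := B) hact hs.eq_zero_of_zpow
    obtain ⟨y, rfl⟩ := exists_cyclicToWreath_eq hact hxs
    obtain ⟨t, ht, k, rfl⟩ := isRooted_freeWreath_int hfree hB y (by
      rintro rfl
      exact hx (map_one _))
    refine ⟨cyclicToWreath B s hact t, ⟨fun m hm => ht.eq_zero_of_zpow m ?_,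
      fun y n hn hy => ?_⟩, k, by simp⟩
    · exact hinj (by rw [map_zpow, hm, map_one])
    · obtain ⟨m, hm⟩ := mem_zpowers_iff.1 hy
      obtain ⟨y, rfl⟩ := exists_cyclicToWreath_eq (x := y) hact (by
        refine hs.mem_of_pow _ n hn ?_
        rw [← map_pow, ← hm, ← map_zpow, rightHom_cyclicToWreath]
        exact zpow_mem (mem_zpowers s) _)
      obtain ⟨j, rfl⟩ := mem_zpowers_iff.1 (ht.mem_of_pow y n hn ⟨m, hinj (by simpa using hm)⟩)
      exact ⟨j, by simp⟩

/-- Commuting elements of a free wreath product, one of which is not in the base. -/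
theorem commute_cases_freeWreath {s : A} (hs : IsIsolatedGenerator s)
    (hX : ∀ (x : X) (a : A) (n : ℕ), 0 < n → a ^ n • x = x → a • x = x)
    {r g : FreeWreath A X B} (h : Commute r g) (hr : rightHom r ∈ zpowers s)
    (hg : rightHom g ∈ zpowers s) (hr1 : rightHom r ≠ 1) :
    (∃ t, r ∈ zpowers t ∧ g ∈ zpowers t) ∨
    ∃ S : Set X, (∀ x ∈ S, s • x = x) ∧
      ∃ (c : FreeWreath A X B) (f f' : FreePower S B) (k k' : ℤ), Commute f f' ∧
        r = c * (inl (reindex B Subtype.val f) * inr (s ^ k)) * c⁻¹ ∧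
        g = c * (inl (reindex B Subtype.val f') * inr (s ^ k')) * c⁻¹ := by
  let _ : MulAction (Multiplicative ℤ) X := MulAction.compHom X (zpowersHom A s)
  have hact : ∀ (z : Multiplicative ℤ) (x : X), z • x = zpowersHom A s z • x := fun _ _ => rfl
  have hfree : ∀ (x : X) (z : Multiplicative ℤ), z ≠ 1 → z • x = x →
      x ∈ MulAction.fixedPoints (Multiplicative ℤ) X := fun x z hz h w =>
    zpow_smul_eq_of_zpow_smul_eq hX (m := z.toAdd) (fun e => hz (Multiplicative.toAdd.injective e)) h _
  have hinj := cyclicToWreath_injective (B := B) hact hs.eq_zero_of_zpow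
  obtain ⟨r, rfl⟩ := exists_cyclicToWreath_eq hact hr
  obtain ⟨g, rfl⟩ := exists_cyclicToWreath_eq hact hg
  have h' : Commute r g := hinj (by simpa using h.eq)
  rcases commute_cases_freeWreath_int hfree h' (fun e => hr1 (by
    rw [rightHom_cyclicToWreath, e, toAdd_one, zpow_zero])) with
    ⟨t, ⟨k, rfl⟩, ⟨l, rfl⟩⟩ | ⟨c, f, f', z, z', hff, rfl, rfl⟩
  · exact Or.inl ⟨cyclicToWreath B s hact t, ⟨k, by simp⟩, ⟨l, by simp⟩⟩
  · refine Or.inr ⟨MulAction.fixedPoints (Multiplicative ℤ) X, fun x hx => ?_,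
      cyclicToWreath B s hact c, f, f', z.toAdd, z'.toAdd, hff, ?_, ?_⟩
    · have : s ^ (1 : ℤ) • x = x := hx (Multiplicative.ofAdd 1)
      simpa using this
    · simp only [map_mul, map_inv, cyclicToWreath_inl, cyclicToWreath_inr]
    · simp only [map_mul, map_inv, cyclicToWreath_inl, cyclicToWreath_inr]

/-- The homomorphism from the free wreath product onto the direct product. -/
def wreathToProd (A X B : Type*) [Group A] [MulAction A X] [Group B] :
    FreeWreath A X B →* B × A :=
  wreathLift (fun _ => MonoidHom.inl B A) (MonoidHom.inr B A) fun a x b => by simp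

theorem wreathToProd_inl_factor (x : X) (b : B) :
    wreathToProd A X B (inl (factor x b)) = (b, 1) :=
  wreathLift_inl_factor _ _ _ _ _

theorem wreathToProd_inr (a : A) : wreathToProd A X B (inr a) = (1, a) :=
  wreathLift_inr _ _ _ _

/-- Two commuting base elements in a common cyclic group are excluded by isolation; otherwise both
lie in a conjugate of one factor, which `wreathToProd` maps isomorphically to `B`. -/
theorem separated_inl {p : ℕ} (hB : IsRootedPCSS p B) {f f' : FreePower X B}
    (hff : Commute f f') (hr : IsIsolatedGenerator (inl f : FreeWreath A X B))
    (hg : (inl f' : FreeWreath A X B) ∉ zpowers (inl f)) :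
    Separated p (inl f : FreeWreath A X B) (inl f') := by
  have hf : IsIsolatedGenerator f := .of_injective inl SemidirectProduct.inl_injective hr
  have hf' : f' ∉ zpowers f := by
    rintro ⟨k, rfl⟩
    exact hg ⟨k, by simp⟩
  rcases commute_cases hff with ⟨t, ht, ht'⟩ | ⟨x, c, u, v, rfl, rfl⟩
  · exact absurd (hf.mem_zpowers_of_mem ht ht') hf'
  · rw [map_mul, map_mul, map_mul, map_mul, map_inv]
    refine Separated.of_conj (.of_hom ((MonoidHom.fst B A).comp (wreathToProd A X B)) ?_)
    have e : ∀ w : B, (MonoidHom.fst B A).comp (wreathToProd A X B) (inl (CoprodI.of (i := x) w)) =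
        w := fun w => congrArg Prod.fst (wreathToProd_inl_factor x w)
    rw [e, e]
    refine hB.separatesIsolated u v ?_ ?_
    · exact .of_injective (factor x) (factor_injective x) hf.of_conj
    · rintro ⟨k, rfl⟩
      exact hf' ⟨k, by simp⟩

/-- The factor at a point fixed by `s` commutes with `s`, and `wreathToProd` embeds their product as
`B × ⟨s⟩` in `B × A`, which is already known to separate. -/
theorem separated_factor {p : ℕ} (hp : p.Prime) (hA : IsRootedPCSS p A) (hB : IsRootedPCSS p B)
    {s : A} (hs : IsIsolatedGenerator s) {x : X} (hx : s • x = x) {u v : B} {k k' : ℤ}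
    (hr : IsIsolatedGenerator (inl (factor x u) * inr (s ^ k) : FreeWreath A X B))
    (hg : (inl (factor x v) * inr (s ^ k') : FreeWreath A X B) ∉
      zpowers (inl (factor x u) * inr (s ^ k))) :
    Separated p (inl (factor x u) * inr (s ^ k) : FreeWreath A X B)
      (inl (factor x v) * inr (s ^ k')) := by
  have hpow : ∀ (b : B) (i m : ℤ), (inl (factor x b) * inr (s ^ i) : FreeWreath A X B) ^ m =
      inl (factor x (b ^ m)) * inr (s ^ (i * m)) := by
    intro b i m
    have hc : Commute (inl (factor x b) : FreeWreath A X B) (inr (s ^ i)) := by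
      have := commute_inl_reindex_inr (A := A) (fun _ : Unit => x) (s ^ i)
        (fun _ => zpow_mem (K := MulAction.stabilizer A x) hx i) (factor () b)
      rwa [reindex_factor] at this
    rw [hc.mul_zpow, ← map_zpow, ← map_zpow, ← map_zpow, zpow_mul]
  have hval : ∀ (b : B) (i : ℤ),
      wreathToProd A X B (inl (factor x b) * inr (s ^ i)) = (b, s ^ i) := by
    intro b i
    rw [map_mul, wreathToProd_inl_factor, wreathToProd_inr]
    simp
  refine .of_hom (wreathToProd A X B) ?_
  rw [hval, hval]
  -- Isolation survives in `B × A`: a root there has its second coordinate in `⟨s⟩`, so it lifts to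
  -- the free wreath product.
  refine (hB.prod hp hA).separatesIsolated _ _ ⟨fun m hm => hr.eq_zero_of_zpow m ?_, ?_⟩ ?_
  · simp only [Prod.pow_mk, Prod.mk_eq_one, ← zpow_mul] at hm
    rw [hpow, hm.1, hm.2, map_one, map_one, map_one, mul_one]
  · rintro ⟨y, z⟩ n hn ⟨m, hm⟩
    simp only [Prod.pow_mk, Prod.mk.injEq, ← zpow_mul] at hm
    obtain ⟨i, rfl⟩ := mem_zpowers_iff.1 (hs.mem_of_pow z n hn ⟨_, hm.2⟩)
    obtain ⟨j, hj⟩ := mem_zpowers_iff.1 (hr.mem_of_pow (inl (factor x y) * inr (s ^ i)) n hn ⟨m, by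
      simp only
      rw [hpow, hm.1, hm.2, ← zpow_natCast (_ * _) n, hpow, zpow_mul, zpow_natCast,
        zpow_natCast]⟩)
    refine ⟨j, ?_⟩
    simp only
    rw [← hval, ← map_zpow, hj, hval]
  · rintro ⟨m, hm⟩
    simp only [Prod.pow_mk, Prod.mk.injEq, ← zpow_mul] at hm
    exact hg ⟨m, by simp only; rw [hpow, hm.1, hm.2]⟩

/-- If `f` is trivial, `r` lies in `A`, and either `A` or the retraction onto `A` separates. If `f`
and `f'` are powers of one `t`, then `t` and `s` span a rank two group, and `rightHom` kills `t` but
not `s`. Otherwise `f` and `f'` lie in a conjugate of one factor, and the conjugator commutes with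
`s`. -/
theorem separated_fixed {p : ℕ} (hp : p.Prime) (hA : IsRootedPCSS p A) (hB : IsRootedPCSS p B)
    (hE : IsResiduallyP p (FreeWreath A X B))
    {s : A} (hs : IsIsolatedGenerator s) {S : Set X} (hS : ∀ x ∈ S, s • x = x)
    {f f' : FreePower S B} (hff : Commute f f') {k k' : ℤ}
    (hr : IsIsolatedGenerator (inl (reindex B Subtype.val f) * inr (s ^ k) : FreeWreath A X B))
    (hg : (inl (reindex B Subtype.val f') * inr (s ^ k') : FreeWreath A X B) ∉
      zpowers (inl (reindex B Subtype.val f) * inr (s ^ k))) :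
    Separated p (inl (reindex B Subtype.val f) * inr (s ^ k) : FreeWreath A X B)
      (inl (reindex B Subtype.val f') * inr (s ^ k')) := by
  have hcomm : ∀ (c : FreePower S B) (i : ℤ),
      Commute (inl (reindex B Subtype.val c) : FreeWreath A X B) (inr (s ^ i)) := fun c i =>
    commute_inl_reindex_inr _ _
      (fun x => zpow_mem (K := MulAction.stabilizer A x.1) (hS x.1 x.2) i) c
  by_cases hf : reindex B (Subtype.val : S → X) f = 1
  · rw [hf, map_one, one_mul] at hr hg ⊢
    by_cases hf' : reindex B (Subtype.val : S → X) f' = 1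
    · rw [hf', map_one, one_mul] at hg ⊢
      refine .of_hom rightHom ?_
      rw [SemidirectProduct.rightHom_inr, SemidirectProduct.rightHom_inr]
      refine hA.separatesIsolated _ _
        (.of_injective inr SemidirectProduct.inr_injective hr) ?_
      rintro ⟨m, hm⟩
      simp only at hm
      exact hg ⟨m, by simp only; rw [← map_zpow, hm]⟩
    · refine hE.separated_of_retraction (inr.comp rightHom) ?_ fun e => hf' ?_
      · rw [MonoidHom.comp_apply, SemidirectProduct.rightHom_inr]
      · rw [MonoidHom.comp_apply, map_mul, SemidirectProduct.rightHom_inr,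
          SemidirectProduct.rightHom_inl, one_mul, right_eq_mul] at e
        exact SemidirectProduct.inl_injective (by rw [e, map_one])
  rcases commute_cases hff with ⟨t, ⟨i, rfl⟩, ⟨j, rfl⟩⟩ | ⟨x, c, u, v, rfl, rfl⟩
  · simp only [map_zpow] at hf hr hg ⊢
    have ht : reindex B (Subtype.val : S → X) t ≠ 1 := fun e => hf (by rw [e, one_zpow])
    have hts := hcomm t 1
    rw [zpow_one] at hts
    refine separated_of_rank_two hp hE hA.isResiduallyP rightHom hts (by simp) (fun m hm => ?_)
      (fun m hm => ?_) fun e => hg (hr.mem_of_proportional hts e)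
    · exact coprodI_eq_zero_of_zpow (fun _ => hB.isRooted) ht
        (SemidirectProduct.inl_injective (by rw [map_zpow, hm, map_one]))
    · exact hs.eq_zero_of_zpow m (by simpa using hm)
  · have e : ∀ (w : B) (i : ℤ),
        (inl (reindex B Subtype.val (c * factor x w * c⁻¹)) * inr (s ^ i) : FreeWreath A X B) =
        inl (reindex B Subtype.val c) * (inl (factor x.1 w) * inr (s ^ i)) *
          (inl (reindex B Subtype.val c))⁻¹ := by
      intro w i
      rw [map_mul, map_mul, map_mul, map_mul, map_inv, map_inv, reindex_factor, mul_assoc,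
        (hcomm c i).inv_left.eq]
      simp only [mul_assoc]
    change IsIsolatedGenerator
      (inl (reindex B Subtype.val (c * factor x u * c⁻¹)) * inr (s ^ k)) at hr
    change inl (reindex B Subtype.val (c * factor x v * c⁻¹)) * inr (s ^ k') ∉
      zpowers (inl (reindex B Subtype.val (c * factor x u * c⁻¹)) * inr (s ^ k)) at hg
    change Separated p (inl (reindex B Subtype.val (c * factor x u * c⁻¹)) * inr (s ^ k))
      (inl (reindex B Subtype.val (c * factor x v * c⁻¹)) * inr (s ^ k'))
    rw [e] at hr
    rw [e, e] at hg ⊢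
    refine Separated.of_conj (separated_factor hp hA hB hs (hS x.1 x.2) hr.of_conj ?_)
    rintro ⟨m, hm⟩
    simp only at hm
    exact hg ⟨m, by simp only; rw [conj_zpow, hm]⟩

/-- Free wreath products over suitable permuted sets. -/
theorem isRootedPCSS_freeWreath {p : ℕ} (hp : p.Prime) (hA : IsRootedPCSS p A)
    (hB : IsRootedPCSS p B)
    (hX : ∀ (x : X) (a : A) (n : ℕ), 0 < n → a ^ n • x = x → a • x = x)
    (hX' : ∀ x y : X, x ≠ y → ∃ N : Subgroup A, IsCoPFinite p N ∧ ∀ n ∈ N, n • y ≠ x) :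
    IsRootedPCSS p (FreeWreath A X B) := by
  have hE := isResiduallyP_freeWreath hp hA.isResiduallyP hB.isResiduallyP hX'
  refine ⟨isRooted_freeWreath hA.isRooted hB.isRooted hX, hE, fun r g hr hg => ?_⟩
  by_cases hcomm : Commute r g
  swap
  · exact hE.separated_of_not_commute hcomm
  by_cases hr1 : rightHom r = 1
  · by_cases hg1 : rightHom g = 1
    · obtain ⟨f, rfl⟩ : r ∈ (inl : FreePower X B →* FreeWreath A X B).range := by
        rw [SemidirectProduct.range_inl_eq_ker_rightHom]
        exact hr1
      obtain ⟨f', rfl⟩ : g ∈ (inl : FreePower X B →* FreeWreath A X B).range := by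
        rw [SemidirectProduct.range_inl_eq_ker_rightHom]
        exact hg1
      refine separated_inl hB (SemidirectProduct.inl_injective (φ := permuteFactors A X B) ?_) hr hg
      rw [map_mul, map_mul]
      exact hcomm
    · refine .of_hom rightHom ?_
      rw [hr1]
      exact hA.isResiduallyP.separated_one hg1
  obtain ⟨s, hs, hrs⟩ := hA.isRooted _ hr1
  -- If the image of `g` is not in `⟨s⟩`, separation already happens in `A`; otherwise `r` and `g`
  -- both lie in the preimage of `⟨s⟩`.
  by_cases hgs : rightHom g ∈ zpowers s
  swap
  · exact .of_hom rightHom ((hA.separatesIsolated s _ hs hgs).of_mem_zpowers hrs)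
  rcases commute_cases_freeWreath hs hX hcomm hrs hgs hr1 with
    ⟨t, ht, ht'⟩ | ⟨S, hS, c, f, f', k, k', hff, rfl, rfl⟩
  · exact absurd (hr.mem_zpowers_of_mem ht ht') hg
  · refine Separated.of_conj (separated_fixed hp hA hB hE hs hS hff hr.of_conj ?_)
    rintro ⟨m, hm⟩
    simp only at hm
    exact hg ⟨m, by simp only; rw [conj_zpow, hm]⟩

/-- Free wreath products over the cosets of the fixed points of an endomorphism. -/
theorem isRootedPCSS_freeWreath_quotient {p : ℕ} (hp : p.Prime) (hA : IsRootedPCSS p A)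
    (hB : IsRootedPCSS p B) (ρ : A →* A) (H : Subgroup A) (hH : ∀ a, a ∈ H ↔ ρ a = a) :
    IsRootedPCSS p (FreeWreath A (A ⧸ H) B) := by
  refine isRootedPCSS_freeWreath hp hA hB (fun x a n hn h => ?_) fun x y hxy => ?_
  · obtain ⟨c, rfl⟩ := QuotientGroup.mk_surjective x
    have h1 : (c⁻¹ * a * c) ^ n ∈ H := by
      have h2 : ((a ^ n * c : A) : A ⧸ H) = c := h
      have h3 := QuotientGroup.eq.1 h2.symm
      have e : (c⁻¹ * a * c) ^ n = c⁻¹ * (a ^ n * c) := by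
        have := conj_pow (i := n) (a := c⁻¹) (b := a)
        rw [inv_inv] at this
        rw [this, mul_assoc]
      rwa [e]
    -- Fixed points of an endomorphism are closed under roots because roots are unique.
    have h4 : ρ (c⁻¹ * a * c) = c⁻¹ * a * c :=
      hA.isRooted.eq_of_pow_eq hn (by rw [← map_pow]; exact (hH _).1 h1)
    have h5 := (hH _).2 h4
    rw [mul_assoc] at h5
    exact (QuotientGroup.eq.2 h5).symm
  · obtain ⟨a, rfl⟩ := QuotientGroup.mk_surjective x
    obtain ⟨b, rfl⟩ := QuotientGroup.mk_surjective y
    set c := b⁻¹ * a with hc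
    have hcH : c ∉ H := fun h => hxy (QuotientGroup.eq.2 h).symm
    -- The element `ρ c * c⁻¹` is the obstruction to `c ∈ H`; it would fall into `N` if some `n ∈ N
    -- ⊓ N.comap ρ` carried the coset of `b` to that of `a`.
    obtain ⟨N, hN, hnot⟩ := hA.isResiduallyP (ρ c * c⁻¹) (fun e =>
      hcH ((hH c).2 (mul_inv_eq_one.1 e)))
    refine ⟨N ⊓ N.comap ρ, hN.inf (hN.comap ρ), fun n hn h => hnot ?_⟩
    have hNn := hN.1
    have h1 : ((n * b : A) : A ⧸ H) = a := h
    have h2 := (hH _).1 (QuotientGroup.eq.1 h1)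
    have hm : (b⁻¹ * n⁻¹ * b) ∈ N ⊓ N.comap ρ := by
      have hn' := (hN.inf (hN.comap ρ)).1
      simpa using hn'.conj_mem _ (inv_mem hn) b⁻¹
    have e : (n * b)⁻¹ * a = (b⁻¹ * n⁻¹ * b) * c := by rw [hc]; group
    rw [e, map_mul] at h2
    have h3 : ρ c * c⁻¹ = (ρ (b⁻¹ * n⁻¹ * b))⁻¹ * (b⁻¹ * n⁻¹ * b) := by
      rw [mul_inv_eq_iff_eq_mul, mul_assoc, ← h2, inv_mul_cancel_left]
    rw [h3]
    exact mul_mem (inv_mem hm.2) hm.1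

end WreathClosure

universe u v

/-! ### Graph products as iterated free wreath products. -/

section GraphProduct

variable {V : Type u} {Γ : SimpleGraph V} {G : V → Type v} [∀ v, Group (G v)]

/-- The defining relators of the graph product. -/
def graphRelators (Γ : SimpleGraph V) (G : V → Type v) [∀ v, Group (G v)] : Set (CoprodI G) :=
  {x : CoprodI G | ∃ v w : V, Γ.Adj v w ∧ ∃ (a : G v) (b : G w),
    x = CoprodI.of a * CoprodI.of b * (CoprodI.of b * CoprodI.of a)⁻¹}

/-- The quotient homomorphism from the free product. -/
def graphMk (Γ : SimpleGraph V) (G : V → Type v) [∀ v, Group (G v)] :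
    CoprodI G →* GraphProduct Γ G :=
  QuotientGroup.mk' (normalClosure (graphRelators Γ G))

/-- The canonical homomorphism from a vertex group. -/
def vertexHom (Γ : SimpleGraph V) (G : V → Type v) [∀ v, Group (G v)] (w : V) :
    G w →* GraphProduct Γ G :=
  (graphMk Γ G).comp CoprodI.of

theorem commute_vertexHom {v w : V} (h : Γ.Adj v w) (a : G v) (b : G w) :
    Commute (vertexHom Γ G v a) (vertexHom Γ G w b) := by
  have h1 : graphMk Γ G (CoprodI.of a * CoprodI.of b * (CoprodI.of b * CoprodI.of a)⁻¹) = 1 :=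
    (QuotientGroup.eq_one_iff _).2 (subset_normalClosure ⟨v, w, h, a, b, rfl⟩)
  rw [map_mul, map_inv, mul_inv_eq_one, map_mul, map_mul] at h1
  exact h1

/-- The homomorphism given by compatible homomorphisms on the vertex groups. -/
def graphLift {M : Type*} [Group M] (f : ∀ v, G v →* M)
    (h : ∀ v w, Γ.Adj v w → ∀ (a : G v) (b : G w), Commute (f v a) (f w b)) :
    GraphProduct Γ G →* M :=
  QuotientGroup.lift (normalClosure (graphRelators Γ G)) (CoprodI.lift f)
    (normalClosure_le_normal (N := (CoprodI.lift f).ker) (by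
      rintro _ ⟨v, w, hvw, a, b, rfl⟩
      simp only [SetLike.mem_coe, MonoidHom.mem_ker, map_mul, map_inv, CoprodI.lift_of,
        mul_inv_eq_one]
      exact h v w hvw a b))

@[simp] theorem graphLift_vertexHom {M : Type*} [Group M] (f : ∀ v, G v →* M)
    (h : ∀ v w, Γ.Adj v w → ∀ (a : G v) (b : G w), Commute (f v a) (f w b)) (v : V) (a : G v) :
    graphLift f h (vertexHom Γ G v a) = f v a :=
  CoprodI.lift_of f a

theorem graphProduct_hom_ext {M : Type*} [Group M] {f g : GraphProduct Γ G →* M}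
    (h : ∀ v a, f (vertexHom Γ G v a) = g (vertexHom Γ G v a)) : f = g := by
  have h1 : f.comp (graphMk Γ G) = g.comp (graphMk Γ G) :=
    CoprodI.ext_hom _ _ fun v => MonoidHom.ext fun a => h v a
  refine MonoidHom.ext fun x => ?_
  obtain ⟨y, rfl⟩ := QuotientGroup.mk'_surjective (normalClosure (graphRelators Γ G)) x
  exact DFunLike.congr_fun h1 y

open Classical in
/-- The retraction which kills the vertex groups outside `S`. -/
noncomputable def retract (Γ : SimpleGraph V) (G : V → Type v) [∀ v, Group (G v)] (S : Set V) :
    GraphProduct Γ G →* GraphProduct Γ G :=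
  graphLift (fun v => if v ∈ S then vertexHom Γ G v else 1) fun v w h a b => by
    split_ifs
    · exact commute_vertexHom h a b
    · exact Commute.one_right _
    · exact Commute.one_left _
    · exact Commute.one_left _

theorem retract_vertexHom_of_mem {S : Set V} {v : V} (h : v ∈ S) (a : G v) :
    retract Γ G S (vertexHom Γ G v a) = vertexHom Γ G v a := by
  simp [retract, h]

theorem retract_vertexHom_of_notMem {S : Set V} {v : V} (h : v ∉ S) (a : G v) :
    retract Γ G S (vertexHom Γ G v a) = 1 := by
  simp [retract, h]

theorem retract_retract (S T : Set V) (x : GraphProduct Γ G) :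
    retract Γ G S (retract Γ G T x) = retract Γ G (S ∩ T) x := by
  have : (retract Γ G S).comp (retract Γ G T) = retract Γ G (S ∩ T) :=
    graphProduct_hom_ext fun v a => by
      rw [MonoidHom.comp_apply]
      by_cases hT : v ∈ T
      · rw [retract_vertexHom_of_mem hT]
        by_cases hS : v ∈ S
        · rw [retract_vertexHom_of_mem hS, retract_vertexHom_of_mem (S := S ∩ T) ⟨hS, hT⟩]
        · rw [retract_vertexHom_of_notMem hS,
            retract_vertexHom_of_notMem fun h : v ∈ S ∩ T => hS h.1]
      · rw [retract_vertexHom_of_notMem hT,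
          retract_vertexHom_of_notMem fun h : v ∈ S ∩ T => hT h.2, map_one]
  exact DFunLike.congr_fun this x

/-- The subgroup generated by the vertex groups of `S`. -/
noncomputable def fullSubgroup (Γ : SimpleGraph V) (G : V → Type v) [∀ v, Group (G v)]
    (S : Set V) : Subgroup (GraphProduct Γ G) :=
  (retract Γ G S).range

/-- The retraction onto a full subgroup. -/
noncomputable def toFullSubgroup (Γ : SimpleGraph V) (G : V → Type v) [∀ v, Group (G v)]
    (S : Set V) : GraphProduct Γ G →* fullSubgroup Γ G S :=
  (retract Γ G S).rangeRestrict

@[simp] theorem coe_toFullSubgroup (S : Set V) (x : GraphProduct Γ G) :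
    (toFullSubgroup Γ G S x : GraphProduct Γ G) = retract Γ G S x := rfl

theorem mem_fullSubgroup_iff {S : Set V} {x : GraphProduct Γ G} :
    x ∈ fullSubgroup Γ G S ↔ retract Γ G S x = x := by
  refine ⟨?_, fun h => ⟨x, h⟩⟩
  rintro ⟨y, rfl⟩
  rw [retract_retract, Set.inter_self]

theorem fullSubgroup_mono {S T : Set V} (h : S ⊆ T) :
    fullSubgroup Γ G S ≤ fullSubgroup Γ G T := by
  rintro _ ⟨x, rfl⟩
  rw [mem_fullSubgroup_iff, retract_retract, Set.inter_eq_self_of_subset_right h]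

theorem exists_finset_mem_fullSubgroup (x : GraphProduct Γ G) :
    ∃ S : Finset V, x ∈ fullSubgroup Γ G S := by
  classical
  obtain ⟨x, rfl⟩ := QuotientGroup.mk'_surjective (normalClosure (graphRelators Γ G)) x
  change ∃ S : Finset V, graphMk Γ G x ∈ fullSubgroup Γ G S
  induction x using CoprodI.induction_on with
  | one => exact ⟨∅, by rw [map_one]; exact one_mem _⟩
  | of v a => exact ⟨{v}, mem_fullSubgroup_iff.2 (retract_vertexHom_of_mem (by simp) a)⟩
  | mul x y hx hy =>
    obtain ⟨S, hS⟩ := hx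
    obtain ⟨T, hT⟩ := hy
    refine ⟨S ∪ T, ?_⟩
    rw [map_mul]
    exact mul_mem (fullSubgroup_mono (by simp) hS) (fullSubgroup_mono (by simp) hT)

theorem commute_retract_neighborSet (v : V) (b : G v) (x : GraphProduct Γ G) :
    Commute (retract Γ G (Γ.neighborSet v) x) (vertexHom Γ G v b) := by
  have : (MulAut.conj (vertexHom Γ G v b)).toMonoidHom.comp (retract Γ G (Γ.neighborSet v)) =
      retract Γ G (Γ.neighborSet v) := graphProduct_hom_ext fun w a => by
    rw [MonoidHom.comp_apply]
    by_cases h : w ∈ Γ.neighborSet v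
    · rw [retract_vertexHom_of_mem h]
      have := (commute_vertexHom (G := G) ((Γ.mem_neighborSet v w).1 h) b a).eq
      change vertexHom Γ G v b * vertexHom Γ G w a * (vertexHom Γ G v b)⁻¹ = _
      rw [this, mul_inv_cancel_right]
    · rw [retract_vertexHom_of_notMem h, map_one]
  have h1 : vertexHom Γ G v b * retract Γ G (Γ.neighborSet v) x * (vertexHom Γ G v b)⁻¹ =
      retract Γ G (Γ.neighborSet v) x := DFunLike.congr_fun this x
  exact (mul_inv_eq_iff_eq_mul.1 h1).symm

/-- The endomorphism of a full subgroup which kills the vertex groups outside the link of `v`. -/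
noncomputable def linkRetract (Γ : SimpleGraph V) (G : V → Type v) [∀ v, Group (G v)] (S : Set V)
    (v : V) : fullSubgroup Γ G S →* fullSubgroup Γ G S :=
  ((retract Γ G (Γ.neighborSet v)).comp (fullSubgroup Γ G S).subtype).codRestrict _ fun x => by
    rw [mem_fullSubgroup_iff]
    conv_rhs => rw [MonoidHom.comp_apply, Subgroup.subtype_apply, ← mem_fullSubgroup_iff.1 x.2]
    rw [MonoidHom.comp_apply, Subgroup.subtype_apply, retract_retract, retract_retract,
      Set.inter_comm]

/-- The subgroup of a full subgroup generated by the vertex groups in the link of `v`. -/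
noncomputable def linkSubgroup (Γ : SimpleGraph V) (G : V → Type v) [∀ v, Group (G v)] (S : Set V)
    (v : V) : Subgroup (fullSubgroup Γ G S) :=
  (linkRetract Γ G S v).eqLocus (MonoidHom.id _)

theorem mem_linkSubgroup_iff {S : Set V} {v : V} {a : fullSubgroup Γ G S} :
    a ∈ linkSubgroup Γ G S v ↔ retract Γ G (Γ.neighborSet v) a = a :=
  ⟨fun h => congrArg Subtype.val (show linkRetract Γ G S v a = a from h),
    fun h => Subtype.ext (a1 := linkRetract Γ G S v a) h⟩

/-- The free wreath product which is isomorphic to the full subgroup on `insert v S`. -/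
abbrev LinkWreath (Γ : SimpleGraph V) (G : V → Type v) [∀ v, Group (G v)] (S : Set V) (v : V) :
    Type _ :=
  FreeWreath (fullSubgroup Γ G S) (fullSubgroup Γ G S ⧸ linkSubgroup Γ G S v) (G v)

open Classical in
/-- The projection of the vertex groups to the vertex group at `v`. -/
noncomputable def vertexProj (G : V → Type v) [∀ v, Group (G v)] (v w : V) : G w →* G v :=
  (Pi.evalMonoidHom G v).comp (MonoidHom.mulSingle G w)

theorem vertexProj_self (v : V) (a : G v) : vertexProj G v v a = a := by
  simp [vertexProj]

theorem vertexProj_of_ne {v w : V} (h : w ≠ v) (a : G w) : vertexProj G v w a = 1 := by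
  simp [vertexProj, h.symm]

open Classical in
/-- The images of the vertex groups in the free wreath product. -/
noncomputable def vertexToLinkWreath (Γ : SimpleGraph V) (G : V → Type v) [∀ v, Group (G v)]
    (S : Set V) (v w : V) : G w →* LinkWreath Γ G S v :=
  if w ∈ S then inr.comp ((toFullSubgroup Γ G S).comp (vertexHom Γ G w))
  else inl.comp ((factor (QuotientGroup.mk 1)).comp (vertexProj G v w))

theorem commute_vertexToLinkWreath_link {S : Set V} {v w : V} (hw : w ∈ S) (hv : v ∉ S)
    (h : Γ.Adj v w) (a : G w) (b : G v) :
    Commute (vertexToLinkWreath Γ G S v w a) (vertexToLinkWreath Γ G S v v b) := by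
  rw [vertexToLinkWreath, if_pos hw, vertexToLinkWreath, if_neg hv]
  simp only [MonoidHom.comp_apply, vertexProj_self]
  set c := (toFullSubgroup Γ G S) (vertexHom Γ G w a) with hc
  have hcS : c ∈ linkSubgroup Γ G S v := by
    rw [mem_linkSubgroup_iff, hc, coe_toFullSubgroup, retract_vertexHom_of_mem hw,
      retract_vertexHom_of_mem ((Γ.mem_neighborSet v w).2 h)]
  have h1 := inr_mul_inl_factor (B := G v) c
    (QuotientGroup.mk 1 : fullSubgroup Γ G S ⧸ linkSubgroup Γ G S v) b
  have h2 : c • (QuotientGroup.mk 1 : fullSubgroup Γ G S ⧸ linkSubgroup Γ G S v) =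
      QuotientGroup.mk 1 :=
    (QuotientGroup.eq (s := linkSubgroup Γ G S v).2 (by simpa using hcS)).symm
  rw [h2] at h1
  exact mul_inv_eq_iff_eq_mul.1 h1

theorem vertexToLinkWreath_eq_one {S : Set V} {v w : V} (hw : w ∉ S) (h : w ≠ v) (a : G w) :
    vertexToLinkWreath Γ G S v w a = 1 := by
  rw [vertexToLinkWreath, if_neg hw]
  simp [vertexProj_of_ne h]

theorem commute_vertexToLinkWreath {S : Set V} {v : V} (hv : v ∉ S) (w x : V) (h : Γ.Adj w x)
    (a : G w) (b : G x) :
    Commute (vertexToLinkWreath Γ G S v w a) (vertexToLinkWreath Γ G S v x b) := by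
  by_cases hw : w ∈ S <;> by_cases hx : x ∈ S
  · rw [vertexToLinkWreath, if_pos hw, vertexToLinkWreath, if_pos hx]
    exact ((commute_vertexHom h a b).map (toFullSubgroup Γ G S)).map inr
  · by_cases hxv : x = v
    · subst hxv
      exact commute_vertexToLinkWreath_link hw hv h.symm a b
    · rw [vertexToLinkWreath_eq_one hx hxv]
      exact Commute.one_right _
  · by_cases hwv : w = v
    · subst hwv
      exact (commute_vertexToLinkWreath_link hx hv h b a).symm
    · rw [vertexToLinkWreath_eq_one hw hwv]
      exact Commute.one_left _
  · by_cases hwv : w = v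
    · rw [vertexToLinkWreath_eq_one hx fun e => h.ne (hwv.trans e.symm)]
      exact Commute.one_right _
    · rw [vertexToLinkWreath_eq_one hw hwv]
      exact Commute.one_left _

/-- The homomorphism from the graph product to the free wreath product. -/
noncomputable def toLinkWreath {S : Set V} {v : V} (hv : v ∉ S) :
    GraphProduct Γ G →* LinkWreath Γ G S v :=
  graphLift (vertexToLinkWreath Γ G S v) (commute_vertexToLinkWreath hv)

theorem toLinkWreath_vertexHom {S : Set V} {v : V} (hv : v ∉ S) (w : V) (a : G w) :
    toLinkWreath (Γ := Γ) hv (vertexHom Γ G w a) = vertexToLinkWreath Γ G S v w a :=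
  graphLift_vertexHom _ _ _ _

/-- The conjugate of a vertex group by a coset of the link subgroup. -/
noncomputable def cosetHom (Γ : SimpleGraph V) (G : V → Type v) [∀ v, Group (G v)] (S : Set V)
    (v : V) (x : fullSubgroup Γ G S ⧸ linkSubgroup Γ G S v) : G v →* GraphProduct Γ G :=
  Quotient.liftOn' x
    (fun a => (MulAut.conj (a : GraphProduct Γ G)).toMonoidHom.comp (vertexHom Γ G v))
    fun a b hab => by
      have h1 := mem_linkSubgroup_iff.1 (QuotientGroup.leftRel_apply.1 hab)
      refine MonoidHom.ext fun g => ?_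
      have h2 := commute_retract_neighborSet v g ((a⁻¹ * b : fullSubgroup Γ G S) :
        GraphProduct Γ G)
      rw [h1] at h2
      change (a : GraphProduct Γ G) * vertexHom Γ G v g * (a : GraphProduct Γ G)⁻¹ =
        b * vertexHom Γ G v g * (b : GraphProduct Γ G)⁻¹
      have h3 : (b : GraphProduct Γ G) =
          a * ((a⁻¹ * b : fullSubgroup Γ G S) : GraphProduct Γ G) := by simp
      rw [h3, mul_assoc (a : GraphProduct Γ G) _ (vertexHom Γ G v g), h2.eq]
      group

theorem cosetHom_mk {S : Set V} {v : V} (a : fullSubgroup Γ G S) (b : G v) :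
    cosetHom Γ G S v (QuotientGroup.mk a) b =
      a * vertexHom Γ G v b * (a : GraphProduct Γ G)⁻¹ := rfl

/-- The homomorphism from the free wreath product to the graph product. -/
noncomputable def ofLinkWreath (Γ : SimpleGraph V) (G : V → Type v) [∀ v, Group (G v)] (S : Set V)
    (v : V) : LinkWreath Γ G S v →* GraphProduct Γ G :=
  wreathLift (cosetHom Γ G S v) (fullSubgroup Γ G S).subtype fun a x b => by
    obtain ⟨c, rfl⟩ := QuotientGroup.mk_surjective x
    change cosetHom Γ G S v (QuotientGroup.mk (a * c)) b = _
    rw [cosetHom_mk, cosetHom_mk, Subgroup.subtype_apply, Subgroup.coe_mul]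
    group

theorem ofLinkWreath_inl {S : Set V} {v : V} (a : fullSubgroup Γ G S) (b : G v) :
    ofLinkWreath Γ G S v (inl (factor (QuotientGroup.mk a) b)) =
      a * vertexHom Γ G v b * (a : GraphProduct Γ G)⁻¹ :=
  wreathLift_inl_factor _ _ _ _ _

theorem ofLinkWreath_inr {S : Set V} {v : V} (a : fullSubgroup Γ G S) :
    ofLinkWreath Γ G S v (inr a) = a :=
  wreathLift_inr _ _ _ _

/-- `toLinkWreath` is defined on the whole graph product and kills every vertex group outside
`insert v S`, so the composite is a retraction rather than the identity. -/
theorem ofLinkWreath_toLinkWreath {S : Set V} {v : V} (hv : v ∉ S) (x : GraphProduct Γ G) :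
    ofLinkWreath Γ G S v (toLinkWreath hv x) = retract Γ G (insert v S) x := by
  have : (ofLinkWreath Γ G S v).comp (toLinkWreath hv) = retract Γ G (insert v S) :=
    graphProduct_hom_ext fun w a => by
      rw [MonoidHom.comp_apply, toLinkWreath_vertexHom]
      by_cases hw : w ∈ S
      · rw [retract_vertexHom_of_mem (Set.mem_insert_of_mem v hw), vertexToLinkWreath, if_pos hw]
        simp only [MonoidHom.comp_apply]
        rw [ofLinkWreath_inr, coe_toFullSubgroup, retract_vertexHom_of_mem hw]
      · by_cases hwv : w = v
        · subst hwv
          rw [retract_vertexHom_of_mem (Set.mem_insert w S), vertexToLinkWreath, if_neg hw]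
          simp only [MonoidHom.comp_apply]
          rw [ofLinkWreath_inl, vertexProj_self]
          simp
        · rw [vertexToLinkWreath_eq_one hw hwv, map_one,
            retract_vertexHom_of_notMem (by simp [hw, hwv])]
  exact DFunLike.congr_fun this x

theorem toLinkWreath_coe {S : Set V} {v : V} (hv : v ∉ S) (a : fullSubgroup Γ G S) :
    toLinkWreath hv (a : GraphProduct Γ G) = inr a := by
  have : (toLinkWreath hv).comp (retract Γ G S) =
      (inr : _ →* LinkWreath Γ G S v).comp (toFullSubgroup Γ G S) :=
    graphProduct_hom_ext fun w a => by
      simp only [MonoidHom.comp_apply]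
      by_cases hw : w ∈ S
      · rw [retract_vertexHom_of_mem hw, toLinkWreath_vertexHom, vertexToLinkWreath, if_pos hw]
        rfl
      · rw [retract_vertexHom_of_notMem hw, map_one]
        have : (toFullSubgroup Γ G S) (vertexHom Γ G w a) = 1 :=
          Subtype.ext (retract_vertexHom_of_notMem hw a)
        rw [this, map_one]
  obtain ⟨_, x, rfl⟩ := a
  exact DFunLike.congr_fun this x

theorem toLinkWreath_ofLinkWreath {S : Set V} {v : V} (hv : v ∉ S) (x : LinkWreath Γ G S v) :
    toLinkWreath hv (ofLinkWreath Γ G S v x) = x := by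
  have : (toLinkWreath hv).comp (ofLinkWreath Γ G S v) = MonoidHom.id _ := by
    refine wreath_hom_ext (fun x b => ?_) fun a => ?_
    · obtain ⟨a, rfl⟩ := QuotientGroup.mk_surjective x
      rw [MonoidHom.comp_apply, ofLinkWreath_inl, map_mul, map_mul, map_inv, toLinkWreath_coe,
        toLinkWreath_vertexHom, vertexToLinkWreath, if_neg hv, MonoidHom.id_apply]
      simp only [MonoidHom.comp_apply, vertexProj_self]
      rw [inr_mul_inl_factor]
      change inl (factor (QuotientGroup.mk (a * 1)) b) = _
      rw [mul_one]
    · rw [MonoidHom.comp_apply, ofLinkWreath_inr, toLinkWreath_coe, MonoidHom.id_apply]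
  exact DFunLike.congr_fun this x

theorem range_ofLinkWreath {S : Set V} {v : V} (hv : v ∉ S) :
    (ofLinkWreath Γ G S v).range = fullSubgroup Γ G (insert v S) := by
  ext x
  constructor
  · rintro ⟨y, rfl⟩
    refine ⟨ofLinkWreath Γ G S v y, ?_⟩
    rw [← ofLinkWreath_toLinkWreath hv, toLinkWreath_ofLinkWreath]
  · rintro ⟨y, rfl⟩
    exact ⟨toLinkWreath hv y, ofLinkWreath_toLinkWreath hv y⟩

/-- Adding a vertex replaces the full subgroup by a free wreath product over the cosets of the link
subgroup, which is by construction the fixed subgroup of `linkRetract`. -/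
theorem isRootedPCSS_fullSubgroup {p : ℕ} (hp : p.Prime) (hG : ∀ v, IsRootedPCSS p (G v))
    (S : Finset V) : IsRootedPCSS p (fullSubgroup Γ G S) := by
  classical
  induction S using Finset.induction_on with
  | empty =>
    have : retract Γ G (∅ : Finset V) = 1 := graphProduct_hom_ext fun v a => by
      rw [retract_vertexHom_of_notMem (by simp)]
      rfl
    have : Subsingleton (fullSubgroup Γ G (∅ : Finset V)) := by
      rw [fullSubgroup, this, MonoidHom.range_one]
      infer_instance
    exact isRootedPCSS_of_subsingleton
  | insert v S hv ih =>
    have hv' : v ∉ (S : Set V) := by simpa using hv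
    have h1 : IsRootedPCSS p (LinkWreath Γ G S v) :=
      isRootedPCSS_freeWreath_quotient hp ih (hG v) (linkRetract Γ G S v) _ fun a => Iff.rfl
    have h2 := h1.of_mulEquiv (MonoidHom.ofInjective (f := ofLinkWreath Γ G S v)
      (Function.LeftInverse.injective (toLinkWreath_ofLinkWreath hv')))
    rw [range_ofLinkWreath hv'] at h2
    rwa [Finset.coe_insert]

/-- Each condition concerns finitely many elements, hence a finite full subgroup; the retraction
onto it transports finite `p`-quotients back to the whole group. -/
theorem isRootedPCSS_graphProduct {p : ℕ} (hp : p.Prime) (hG : ∀ v, IsRootedPCSS p (G v)) :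
    IsRootedPCSS p (GraphProduct Γ G) := by
  classical
  have hS := isRootedPCSS_fullSubgroup (Γ := Γ) hp hG
  refine ⟨fun g hg => ?_, fun g hg => ?_, fun r g hr hg => ?_⟩
  · obtain ⟨S, hgS⟩ := exists_finset_mem_fullSubgroup g
    obtain ⟨⟨r, hrS⟩, hr, k, hk⟩ := (hS S).isRooted ⟨g, hgS⟩ fun e => hg (congrArg Subtype.val e)
    refine ⟨r, ⟨fun m hm => hr.eq_zero_of_zpow m (Subtype.ext hm), fun x n hn hx => ?_⟩, k,
      congrArg Subtype.val hk⟩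
    obtain ⟨m, hm⟩ := mem_zpowers_iff.1 hx
    have hxn : x ^ n ∈ fullSubgroup Γ G S := hm ▸ zpow_mem hrS m
    -- A root of an element of the full subgroup stays in it: `x` and its retract have the same
    -- `n`-th power, and roots are unique in a larger finite full subgroup containing both.
    have hxS : x ∈ fullSubgroup Γ G S := by
      obtain ⟨T, hT⟩ := exists_finset_mem_fullSubgroup x
      have h1 : retract Γ G S x ∈ fullSubgroup Γ G (S ∪ T : Finset V) :=
        fullSubgroup_mono (by simp) ⟨x, rfl⟩
      have h2 : x ∈ fullSubgroup Γ G (S ∪ T : Finset V) := fullSubgroup_mono (by simp) hT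
      have h3 := (hS (S ∪ T)).isRooted.eq_of_pow_eq (x := ⟨_, h1⟩) (y := ⟨_, h2⟩) hn
        (Subtype.ext (by
          change retract Γ G S x ^ n = x ^ n
          rw [← map_pow]
          exact mem_fullSubgroup_iff.1 hxn))
      exact mem_fullSubgroup_iff.2 (congrArg Subtype.val h3)
    obtain ⟨j, hj⟩ := mem_zpowers_iff.1 (hr.mem_of_pow ⟨x, hxS⟩ n hn ⟨m, Subtype.ext hm⟩)
    exact ⟨j, congrArg Subtype.val hj⟩
  · obtain ⟨S, hgS⟩ := exists_finset_mem_fullSubgroup g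
    obtain ⟨N, hN, h⟩ := (hS S).isResiduallyP ⟨g, hgS⟩ fun e => hg (congrArg Subtype.val e)
    refine ⟨N.comap (toFullSubgroup Γ G S), hN.comap _, fun h' => h ?_⟩
    have e : (toFullSubgroup Γ G S) g = ⟨g, hgS⟩ :=
      Subtype.ext (mem_fullSubgroup_iff.1 hgS)
    rwa [mem_comap, e] at h'
  · obtain ⟨S, hgS⟩ := exists_finset_mem_fullSubgroup g
    obtain ⟨T, hrT⟩ := exists_finset_mem_fullSubgroup r
    have hg' : g ∈ fullSubgroup Γ G (S ∪ T : Finset V) := fullSubgroup_mono (by simp) hgS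
    have hr' : r ∈ fullSubgroup Γ G (S ∪ T : Finset V) := fullSubgroup_mono (by simp) hrT
    refine .of_hom (toFullSubgroup Γ G (S ∪ T : Finset V)) ?_
    have e1 : (toFullSubgroup Γ G (S ∪ T : Finset V)) g = ⟨g, hg'⟩ :=
      Subtype.ext (mem_fullSubgroup_iff.1 hg')
    have e2 : (toFullSubgroup Γ G (S ∪ T : Finset V)) r = ⟨r, hr'⟩ :=
      Subtype.ext (mem_fullSubgroup_iff.1 hr')
    rw [e1, e2]
    refine (hS (S ∪ T)).separatesIsolated _ _
      (.of_injective (fullSubgroup Γ G _).subtype (subtype_injective _) hr) ?_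
    rintro ⟨m, hm⟩
    exact hg ⟨m, congrArg Subtype.val hm⟩

end GraphProduct

end ProPGraph

theorem theoremC (p : ℕ) (hp : p.Prime) {V : Type*} (Γ : SimpleGraph V)
    (G : V → Type*) [∀ v, Group (G v)]
    (hU : ∀ v, ProPGraph.InUpsilon (G v)) (hC : ∀ v, ProPGraph.IsPCSS p (G v)) :
    ProPGraph.InUpsilon (ProPGraph.GraphProduct Γ G) ∧
      ProPGraph.IsPCSS p (ProPGraph.GraphProduct Γ G) := by
  have h := ProPGraph.isRootedPCSS_graphProduct (Γ := Γ) hp fun v =>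
    ProPGraph.IsPCSS.isRootedPCSS (hU v) (hC v)
  exact ⟨h.isRooted.inUpsilon, h.isPCSS hp⟩
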